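/- **Conventions.** Indices $a,b,c,d$ run over $1,\dots,p$, indices $\alpha,\beta,\gamma,\delta$ over the fiber coordinates; repeated indices are summed. For a semi-Riemannian metric $g$ with Christoffel symbols $\Gamma^k_{ij}$ let $$R_{hijk}=g_{hl}\left(\partial_j\Gamma^l_{ik}-\partial_k\Gamma^l_{ij}+\Gamma^m_{ik}\Gamma^l_{mj}-\Gamma^m_{ij}\Gamma^l_{mk}\right),\qquad S_{jk}=g^{il}R_{ijkl},$$ and for $(0,2)$ tensors $A,E$ let $(A\wedge E)_{ijkl}=A_{il}E_{jk}+A_{jk}E_{il}-A_{ik}E_{jl}-A_{jl}E_{ik}$. **Setting.** Let $(\overline M,\overline g)$ and $(\widetilde M,\widetilde g)$ be connected smooth semi-Riemannian manifolds of dimensions $p\ge 1$ and $n-p\ge 1$, with $n\ge 3$, let $f:\overline M\to(0,\infty)$ be smooth, and let $M=\overline M\times_f\widetilde M$ be the warped product, i.e. $\overline M\times\widetilde M$ with the metric $g=\pi^*\overline g+(f\circ\pi)\,\sigma^*\widetilde g$, where $\pi,\sigma$ are the projections to $\overline M$ and $\widetilde M$. Write $R,S$ (resp. $\overline R,\overline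 S$; $\widetilde R,\widetilde S$) for the tensors above formed with $g$ (resp. $\overline g$; $\widetilde g$). On $\overline M$ put, with $f_a=\partial_a f$ and $\overline\nabla$ the Levi-Civita connection of $\overline g$, $$T_{ab}=-\frac1{2f}\left(\overline\nabla_b f_a-\frac1{2f}f_af_b\right),\qquad P=\frac1{4f^2}\,\overline g^{ab}f_af_b,\qquad Q=f\left((n-p-1)P-\overline g^{ab}T_{ab}\right).$$ **Statement.** Suppose that $M$ is not flat ($R\not\equiv 0$), and let $N_1,N_2,N_3$ be real functions on $M$. Then $$R=N_1\,g\wedge g+N_2\,g\wedge S+N_3\,S\wedge S\quad\text{on } M$$ if and only if the following three conditions hold at every point $(x,y)$ of $\overline M\times\widetilde M$ (tensors and scalars of $\overline M$ are taken at $x$, those of $\widetilde M$ at $y$, and $N_1,N_2,N_3$ at $(x,y)$): (i) $\overline R=N_1\,\overline g\wedge\overline g+N_2\,\overline g\wedge\overline S-(n-p)N_2\,\overline g\wedge T+N_3\,\overline S\wedge\overline S-2(n-p)N_3\,\overline S\wedge T+(n-p)^2N_3\,T\wedge T$; (ii) for all $a,b,\alpha,\beta$, $$\begin{aligned}&(-2fN_1-N_2Q)\,\overline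 g_{ab}\widetilde g_{\alpha\beta}+(-fN_2-2N_3Q)\,\overline S_{ab}\widetilde g_{\alpha\beta}+\bigl(-f(1-(n-p)N_2)+2(n-p)N_3Q\bigr)T_{ab}\widetilde g_{\alpha\beta}\\&\quad-N_2\,\overline g_{ab}\widetilde S_{\alpha\beta}-2N_3\,\overline S_{ab}\widetilde S_{\alpha\beta}+2(n-p)N_3\,T_{ab}\widetilde S_{\alpha\beta}=0;\end{aligned}$$ (iii) $f\widetilde R=\left(N_1f^2+N_2Qf+N_3Q^2-\tfrac12f^2P\right)\widetilde g\wedge\widetilde g+\left(fN_2+2N_3Q\right)\widetilde g\wedge\widetilde S+N_3\,\widetilde S\wedge\widetilde S.$ -/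

import Mathlib

open scoped Manifold ContDiff

noncomputable section

namespace WarpedRoter

/-! ### Tensor calculus in one coordinate system

`E` is a finite-dimensional real vector space with a basis `b`, whose elements are the coordinate
directions; a metric is given by its matrix of components `G u` at the points `u` of an open
subset of `E`. -/

section Coordinates

variable {ι : Type*} [Fintype ι] [DecidableEq ι]
variable {E : Type*} [NormedAddCommGroup E] [NormedSpace ℝ E]

/-- The partial derivative `∂_i F` at `u`. -/
def pderiv (b : Module.Basis ι ℝ E) (i : ι) (F : E → ℝ) (u : E) : ℝ :=
  fderiv ℝ F u (b i)

/-- The Christoffel symbols `Γ^k_{ij} = ½ g^{kl} (∂_i g_{jl} + ∂_j g_{il} - ∂_l g_{ij})` of the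
Levi-Civita connection. -/
def christoffel (b : Module.Basis ι ℝ E) (G : E → Matrix ι ι ℝ) (k i j : ι) (u : E) : ℝ :=
  (1 / 2) * ∑ l, (G u)⁻¹ k l *
    (pderiv b i (fun v => G v j l) u + pderiv b j (fun v => G v i l) u
      - pderiv b l (fun v => G v i j) u)

/-- The components of the Riemann-Christoffel curvature tensor
`R_{hijk} = g_{hl} (∂_j Γ^l_{ik} - ∂_k Γ^l_{ij} + Γ^m_{ik} Γ^l_{mj} - Γ^m_{ij} Γ^l_{mk})`,
that is, `R_{hijk} = g([∇_j, ∇_k] ∂_i, ∂_h)`. -/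
def riemann (b : Module.Basis ι ℝ E) (G : E → Matrix ι ι ℝ) (h i j k : ι) (u : E) : ℝ :=
  ∑ l, G u h l *
    (pderiv b j (christoffel b G l i k) u - pderiv b k (christoffel b G l i j) u
      + ∑ m, (christoffel b G m i k u * christoffel b G l m j u
          - christoffel b G m i j u * christoffel b G l m k u))

/-- The Ricci tensor `S_{jk} = g^{il} R_{ijkl}`. -/
def ricci (b : Module.Basis ι ℝ E) (G : E → Matrix ι ι ℝ) (j k : ι) (u : E) : ℝ :=
  ∑ i, ∑ l, (G u)⁻¹ i l * riemann b G i j k l u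

/-- The second covariant derivative `∇_c ∂_a F = ∂_c ∂_a F - Γ^d_{ca} ∂_d F`. -/
def hessian (b : Module.Basis ι ℝ E) (G : E → Matrix ι ι ℝ) (F : E → ℝ) (a c : ι) (u : E) : ℝ :=
  pderiv b c (pderiv b a F) u - ∑ d, christoffel b G d c a u * pderiv b d F u

end Coordinates

/-- The Kulkarni-Nomizu product of two `(0,2)` tensors, in components:
`(A ∧ B)_{ijkl} = A_{il} B_{jk} + A_{jk} B_{il} - A_{ik} B_{jl} - A_{jl} B_{ik}`. -/
def kulkarniNomizu {ι : Type*} (A B : Matrix ι ι ℝ) (i j k l : ι) : ℝ :=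
  A i l * B j k + A j k * B i l - A i k * B j l - A j l * B i k

/-! ### Semi-Riemannian metrics on manifolds and their curvature in charts -/

section Manifold

variable {E : Type*} [NormedAddCommGroup E] [NormedSpace ℝ E]
variable {H : Type*} [TopologicalSpace H]

/-- A field of bilinear forms on the tangent spaces of `M`. -/
abbrev BilinField (I : ModelWithCorners ℝ E H) (M : Type*) [TopologicalSpace M]
    [ChartedSpace H M] :=
  ∀ x : M, TangentSpace I x →L[ℝ] TangentSpace I x →L[ℝ] ℝ

/-- A semi-Riemannian metric on `M`: a smooth field of symmetric nondegenerate bilinear forms on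
the tangent spaces, of any signature. -/
structure SemiRiemannianMetric (I : ModelWithCorners ℝ E H) (M : Type*) [TopologicalSpace M]
    [ChartedSpace H M] [IsManifold I ∞ M] where
  /-- The bilinear form on the tangent space at `x`. -/
  val : BilinField I M
  symm : ∀ (x : M) (v w : TangentSpace I x), val x v w = val x w v
  nondegenerate : ∀ (x : M) (v : TangentSpace I x), (∀ w, val x v w = 0) → v = 0
  smooth : ContMDiff I (I.prod 𝓘(ℝ, E →L[ℝ] E →L[ℝ] ℝ)) ∞
    (fun x ↦ Bundle.TotalSpace.mk' (E →L[ℝ] E →L[ℝ] ℝ)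
      (E := fun x : M ↦ (TangentSpace I x →L[ℝ] TangentSpace I x →L[ℝ] ℝ)) x (val x))

variable {ι : Type*} [Fintype ι] [DecidableEq ι]
variable {M : Type*} [TopologicalSpace M] [ChartedSpace H M]

/-- The coordinate vector field `∂_i` of the chart `e`, at the point with coordinates `u`. -/
def coordVec (I : ModelWithCorners ℝ E H) (b : Module.Basis ι ℝ E)
    (e : OpenPartialHomeomorph M H) (i : ι) (u : E) : TangentSpace I ((e.extend I).symm u) :=
  mfderiv 𝓘(ℝ, E) I (e.extend I).symm u (b i)

/-- The components `g_{ij} = g(∂_i, ∂_j)` in the chart `e`, as functions of the coordinates. -/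
def components (I : ModelWithCorners ℝ E H) (b : Module.Basis ι ℝ E) (g : BilinField I M)
    (e : OpenPartialHomeomorph M H) (u : E) : Matrix ι ι ℝ :=
  Matrix.of fun i j => g ((e.extend I).symm u) (coordVec I b e i u) (coordVec I b e j u)

/-- The matrix `g_{ij}` at the point `x`, in the chart `e`. -/
def metricAt (I : ModelWithCorners ℝ E H) (b : Module.Basis ι ℝ E) (g : BilinField I M)
    (e : OpenPartialHomeomorph M H) (x : M) : Matrix ι ι ℝ :=
  components I b g e (e.extend I x)

/-- The components `R_{ijkl}` of the curvature tensor of `g` at the point `x`, in the chart `e`. -/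
def riemannAt (I : ModelWithCorners ℝ E H) (b : Module.Basis ι ℝ E) (g : BilinField I M)
    (e : OpenPartialHomeomorph M H) (x : M) (i j k l : ι) : ℝ :=
  riemann b (components I b g e) i j k l (e.extend I x)

/-- The components `S_{ij}` of the Ricci tensor of `g` at the point `x`, in the chart `e`. -/
def ricciAt (I : ModelWithCorners ℝ E H) (b : Module.Basis ι ℝ E) (g : BilinField I M)
    (e : OpenPartialHomeomorph M H) (x : M) : Matrix ι ι ℝ :=
  Matrix.of fun i j => ricci b (components I b g e) i j (e.extend I x)

/-- `g` is flat: its curvature tensor vanishes identically. -/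
def IsFlat (I : ModelWithCorners ℝ E H) (b : Module.Basis ι ℝ E) (g : BilinField I M) : Prop :=
  ∀ e ∈ atlas H M, ∀ x ∈ e.source, ∀ i j k l, riemannAt I b g e x i j k l = 0

/-- The Roter type condition `R = N₁ g ∧ g + N₂ g ∧ S + N₃ S ∧ S` on `(M, g)`, with associated
scalars `N₁`, `N₂`, `N₃`: equality of the components of both sides in every chart of the atlas. -/
def IsRoterTypeWith (I : ModelWithCorners ℝ E H) (b : Module.Basis ι ℝ E) (g : BilinField I M)
    (N₁ N₂ N₃ : M → ℝ) : Prop :=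
  ∀ e ∈ atlas H M, ∀ x ∈ e.source, ∀ i j k l,
    riemannAt I b g e x i j k l =
      N₁ x * kulkarniNomizu (metricAt I b g e x) (metricAt I b g e x) i j k l
      + N₂ x * kulkarniNomizu (metricAt I b g e x) (ricciAt I b g e x) i j k l
      + N₃ x * kulkarniNomizu (ricciAt I b g e x) (ricciAt I b g e x) i j k l

/-- The components of `T_{ab} = -(1/(2f)) (∇_b f_a - (1/(2f)) f_a f_b)`, where `f_a = ∂_a f`, at
the point `x`, in the chart `e`. -/
def tensorT (I : ModelWithCorners ℝ E H) (b : Module.Basis ι ℝ E) (g : BilinField I M)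
    (f : M → ℝ) (e : OpenPartialHomeomorph M H) (x : M) : Matrix ι ι ℝ :=
  Matrix.of fun a c =>
    -(1 / (2 * f x)) *
      (hessian b (components I b g e) (f ∘ (e.extend I).symm) a c (e.extend I x)
        - 1 / (2 * f x) * (pderiv b a (f ∘ (e.extend I).symm) (e.extend I x)
            * pderiv b c (f ∘ (e.extend I).symm) (e.extend I x)))

/-- The trace `tr(T) = g^{ab} T_{ab}` at the point `x`, computed in the chart `e`. -/
def traceT (I : ModelWithCorners ℝ E H) (b : Module.Basis ι ℝ E) (g : BilinField I M)
    (f : M → ℝ) (e : OpenPartialHomeomorph M H) (x : M) : ℝ :=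
  ∑ a, ∑ c, (metricAt I b g e x)⁻¹ a c * tensorT I b g f e x a c

/-- The scalar `P = (1/(4f²)) g^{ab} f_a f_b` at the point `x`, computed in the chart `e`. -/
def scalarP (I : ModelWithCorners ℝ E H) (b : Module.Basis ι ℝ E) (g : BilinField I M)
    (f : M → ℝ) (e : OpenPartialHomeomorph M H) (x : M) : ℝ :=
  1 / (4 * f x ^ 2) * ∑ a, ∑ c, (metricAt I b g e x)⁻¹ a c *
    (pderiv b a (f ∘ (e.extend I).symm) (e.extend I x)
      * pderiv b c (f ∘ (e.extend I).symm) (e.extend I x))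

/-- The scalar `Q = f ((m - 1) P - tr(T))` at the point `x`, computed in the chart `e`; here `m` is
the dimension of the fiber. -/
def scalarQ (I : ModelWithCorners ℝ E H) (b : Module.Basis ι ℝ E) (g : BilinField I M)
    (f : M → ℝ) (m : ℕ) (e : OpenPartialHomeomorph M H) (x : M) : ℝ :=
  f x * (((m : ℝ) - 1) * scalarP I b g f e x - traceT I b g f e x)

end Manifold

/-! ### Warped products -/

section Warped

variable {E : Type*} [NormedAddCommGroup E] [NormedSpace ℝ E]
  {H : Type*} [TopologicalSpace H] {I : ModelWithCorners ℝ E H}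
  {E' : Type*} [NormedAddCommGroup E'] [NormedSpace ℝ E']
  {H' : Type*} [TopologicalSpace H'] {I' : ModelWithCorners ℝ E' H'}
  {B : Type*} [TopologicalSpace B] [ChartedSpace H B]
  {F : Type*} [TopologicalSpace F] [ChartedSpace H' F]

/-- The pull-back `(v, w) ↦ A (L v) (L w)` of a bilinear form along a linear map. -/
def pullbackForm {V W : Type*} [AddCommGroup V] [Module ℝ V] [TopologicalSpace V]
    [IsTopologicalAddGroup V] [ContinuousConstSMul ℝ V]
    [AddCommGroup W] [Module ℝ W] [TopologicalSpace W]
    [IsTopologicalAddGroup W] [ContinuousConstSMul ℝ W]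
    (A : V →L[ℝ] V →L[ℝ] ℝ) (L : W →L[ℝ] V) : W →L[ℝ] W →L[ℝ] ℝ :=
  (ContinuousLinearMap.precomp ℝ L).comp (A.comp L)

/-- The warped product metric `g = π^* g_B + (f ∘ π) σ^* g_F` on `B × F`, where `π` and `σ` are the
projections. -/
def warpedMetric (gB : BilinField I B) (f : B → ℝ) (gF : BilinField I' F) :
    BilinField (I.prod I') (B × F) := fun z =>
  pullbackForm (gB z.1) (mfderiv (I.prod I') I (Prod.fst : B × F → B) z)
    + f z.1 • pullbackForm (gF z.2) (mfderiv (I.prod I') I' (Prod.snd : B × F → F) z)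

end Warped

/-- The standard coordinates on `ℝᵖ`. -/
abbrev coords (p : ℕ) : Module.Basis (Fin p) ℝ (EuclideanSpace ℝ (Fin p)) :=
  (EuclideanSpace.basisFun (Fin p) ℝ).toBasis

end WarpedRoter

end

open WarpedRoter

noncomputable section

namespace WarpedRoter

open Matrix Filter Topology

/-! ### Partial derivatives -/

section PartialDerivatives

variable {ι : Type*} {κ : Type*}
variable {E : Type*} [NormedAddCommGroup E] [NormedSpace ℝ E]
variable {E' : Type*} [NormedAddCommGroup E'] [NormedSpace ℝ E']
variable (b : Module.Basis ι ℝ E) (b' : Module.Basis κ ℝ E')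

/-! The Roter equation is an identity between components at each point, so the proof is a block
computation in product coordinates. There the metric is block diagonal, with blocks `A` and `φ • D`,
and every Christoffel symbol is zero or a product of a function on the base and a function on the
fiber. In terms of `s = df / (2f)`, the logarithmic derivative of `√f`, the only new symbols are
`Γ^γ_{aβ} = s_a δ^γ_β` and `Γ^c_{αβ} = -½ (grad f)^c D_{αβ}`.

Up to antisymmetry in the last two indices, four types of curvature blocks survive: the base
curvature; the two mixed blocks `-f T_{ab} D_{αβ}` (`riemann_lrrl`, `riemann_rllr`); and the fiber
block `f R̃ + ½ f² P (D ∧ D)` (`riemann_rrrr`). Here `T = -∇²√f / √f` and `P = |s|²`. Contracting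
gives a block diagonal Ricci tensor with blocks `S̄ - (n-p) T` and `S̃ + Q D` (`ricci_ll`,
`ricci_rr`).

Inserting these blocks into the Roter equation (`roter_iff`), the purely base, mixed and purely
fiber components become (i), (ii) and (iii); all other components read `0 = 0`. The passage to
manifolds (`roter_warpedMetric_iff`) needs no change of coordinates, because the atlas of `B × F`
consists exactly of the products of charts. -/

theorem pderiv_congr {F K : E → ℝ} {u : E} (h : F =ᶠ[𝓝 u] K) (i : ι) :
    pderiv b i F u = pderiv b i K u := by
  rw [pderiv, pderiv, h.fderiv_eq]

theorem pderiv_congr_of_eqOn {U : Set E} (hU : IsOpen U) {F K : E → ℝ} (h : Set.EqOn F K U)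
    {u : E} (hu : u ∈ U) (i : ι) : pderiv b i F u = pderiv b i K u :=
  pderiv_congr b (h.eventuallyEq_of_mem (hU.mem_nhds hu)) i

@[simp] theorem pderiv_const (c : ℝ) (i : ι) (u : E) : pderiv b i (fun _ => c) u = 0 := by
  simp [pderiv]

theorem pderiv_mul {F K : E → ℝ} {u : E} (hF : DifferentiableAt ℝ F u)
    (hK : DifferentiableAt ℝ K u) (i : ι) :
    pderiv b i (fun v => F v * K v) u = F u * pderiv b i K u + pderiv b i F u * K u := by
  simp only [pderiv]
  rw [fderiv_fun_mul hF hK]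
  simp [mul_comm]

theorem pderiv_const_mul {F : E → ℝ} {u : E} (hF : DifferentiableAt ℝ F u) (c : ℝ) (i : ι) :
    pderiv b i (fun v => c * F v) u = c * pderiv b i F u := by
  simp [pderiv, fderiv_const_mul hF]

theorem pderiv_sum {σ : Type*} (s : Finset σ) {F : σ → E → ℝ} {u : E}
    (hF : ∀ m ∈ s, DifferentiableAt ℝ (F m) u) (i : ι) :
    pderiv b i (fun v => ∑ m ∈ s, F m v) u = ∑ m ∈ s, pderiv b i (F m) u := by
  simp only [pderiv]
  rw [fderiv_fun_sum hF]
  simp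

theorem pderiv_inv {F : E → ℝ} {u : E} (hF : DifferentiableAt ℝ F u) (h0 : F u ≠ 0) (i : ι) :
    pderiv b i (fun v => (F v)⁻¹) u = -(pderiv b i F u) / F u ^ 2 := by
  simp only [pderiv]
  have := (HasFDerivAt.comp u (hasFDerivAt_inv h0) hF.hasFDerivAt).fderiv
  rw [show (fun v => (F v)⁻¹) = (fun x => x⁻¹) ∘ F from rfl, this]
  simp
  ring

/-- Both iterated derivatives are values of the second Fréchet derivative, which is symmetric. This
is what makes `sqrtLogDeriv` a closed form, hence `riemann_rrll`. -/
theorem pderiv_comm {U : Set E} (hU : IsOpen U) {F : E → ℝ} (hF : ContDiffOn ℝ ∞ F U) {u : E}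
    (hu : u ∈ U) (i j : ι) :
    pderiv b i (pderiv b j F) u = pderiv b j (pderiv b i F) u := by
  have hFu : ContDiffAt ℝ ∞ F u := hF.contDiffAt (hU.mem_nhds hu)
  have hd : DifferentiableAt ℝ (fderiv ℝ F) u :=
    (hFu.fderiv_right (m := 1) (by norm_cast)).differentiableAt (by simp)
  have key : ∀ k l : ι, pderiv b k (pderiv b l F) u = fderiv ℝ (fderiv ℝ F) u (b k) (b l) := by
    intro k l
    have h : HasFDerivAt (pderiv b l F)
        ((ContinuousLinearMap.apply ℝ ℝ (b l)).comp (fderiv ℝ (fderiv ℝ F) u)) u :=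
      (ContinuousLinearMap.apply ℝ ℝ (b l)).hasFDerivAt.comp u hd.hasFDerivAt
    rw [pderiv, h.fderiv]
    simp
  rw [key, key]
  exact (hFu.isSymmSndFDerivAt (by simp; norm_cast)).eq _ _

theorem contDiffOn_pderiv {U : Set E} (hU : IsOpen U) {F : E → ℝ} (hF : ContDiffOn ℝ ∞ F U)
    (i : ι) : ContDiffOn ℝ ∞ (pderiv b i F) U :=
  (hF.fderiv_of_isOpen hU (by simp)).clm_apply contDiffOn_const

theorem differentiableAt_of_contDiffOn {U : Set E} (hU : IsOpen U) {F : E → ℝ}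
    (hF : ContDiffOn ℝ ∞ F U) {u : E} (hu : u ∈ U) : DifferentiableAt ℝ F u :=
  (hF.contDiffAt (hU.mem_nhds hu)).differentiableAt (by simp)

variable {F : E → ℝ} {K : E' → ℝ} {z : E × E'}

/-- Separated products suffice: all components and Christoffel symbols of a warped product have this
form, possibly with a constant factor. -/
theorem pderiv_prod_mul_inl (hF : DifferentiableAt ℝ F z.1) (hK : DifferentiableAt ℝ K z.2)
    (i : ι) :
    pderiv (b.prod b') (Sum.inl i) (fun w => F w.1 * K w.2) z = pderiv b i F z.1 * K z.2 := by
  have h1 : HasFDerivAt (fun w : E × E' => F w.1) _ z :=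
    hF.hasFDerivAt.comp z (hasFDerivAt_fst (p := z))
  have h2 : HasFDerivAt (fun w : E × E' => K w.2) _ z :=
    hK.hasFDerivAt.comp z (hasFDerivAt_snd (p := z))
  simp only [pderiv]
  rw [(h1.fun_mul h2).fderiv]
  simp [mul_comm]

theorem pderiv_prod_mul_inr (hF : DifferentiableAt ℝ F z.1) (hK : DifferentiableAt ℝ K z.2)
    (i : κ) :
    pderiv (b.prod b') (Sum.inr i) (fun w => F w.1 * K w.2) z = F z.1 * pderiv b' i K z.2 := by
  have h1 : HasFDerivAt (fun w : E × E' => F w.1) _ z :=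
    hF.hasFDerivAt.comp z (hasFDerivAt_fst (p := z))
  have h2 : HasFDerivAt (fun w : E × E' => K w.2) _ z :=
    hK.hasFDerivAt.comp z (hasFDerivAt_snd (p := z))
  simp only [pderiv]
  rw [(h1.fun_mul h2).fderiv]
  simp

theorem pderiv_fst_inl (hF : DifferentiableAt ℝ F z.1) (i : ι) :
    pderiv (b.prod b') (Sum.inl i) (fun w => F w.1) z = pderiv b i F z.1 := by
  simpa using pderiv_prod_mul_inl b b' (K := fun _ => 1) hF (differentiableAt_const _) i

theorem pderiv_fst_inr (hF : DifferentiableAt ℝ F z.1) (i : κ) :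
    pderiv (b.prod b') (Sum.inr i) (fun w => F w.1) z = 0 := by
  simpa using pderiv_prod_mul_inr b b' (K := fun _ => 1) hF (differentiableAt_const _) i

theorem pderiv_snd_inl (hK : DifferentiableAt ℝ K z.2) (i : ι) :
    pderiv (b.prod b') (Sum.inl i) (fun w => K w.2) z = 0 := by
  simpa using pderiv_prod_mul_inl b b' (F := fun _ => 1) (differentiableAt_const _) hK i

theorem pderiv_snd_inr (hK : DifferentiableAt ℝ K z.2) (i : κ) :
    pderiv (b.prod b') (Sum.inr i) (fun w => K w.2) z = pderiv b' i K z.2 := by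
  simpa using pderiv_prod_mul_inr b b' (F := fun _ => 1) (differentiableAt_const _) hK i

end PartialDerivatives

/-! ### Smooth metrics in coordinates -/

section Metrics

variable {ι : Type*} [Fintype ι] [DecidableEq ι]
variable {E : Type*} [NormedAddCommGroup E] [NormedSpace ℝ E]

/-- `A` is the matrix of components of a smooth semi-Riemannian metric on the open set `U`. -/
structure IsMetricOn (U : Set E) (A : E → Matrix ι ι ℝ) : Prop where
  isOpen : IsOpen U
  smooth : ∀ i j, ContDiffOn ℝ ∞ (fun u => A u i j) U
  symm : ∀ u ∈ U, ∀ i j, A u i j = A u j i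
  isUnit_det : ∀ u ∈ U, IsUnit (A u).det

theorem contDiffOn_det {U : Set E} {A : E → Matrix ι ι ℝ}
    (hA : ∀ i j, ContDiffOn ℝ ∞ (fun u => A u i j) U) :
    ContDiffOn ℝ ∞ (fun u => (A u).det) U := by
  simp only [det_apply']
  exact ContDiffOn.sum fun σ _ => contDiffOn_const.mul (contDiffOn_prod fun i _ => hA _ _)

namespace IsMetricOn

variable {U : Set E} {A : E → Matrix ι ι ℝ} (hA : IsMetricOn U A)
include hA

/-- Cramer's rule writes the entry as a quotient of determinants, whose denominator does not vanish
on `U`. -/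
theorem smooth_inv (i j : ι) : ContDiffOn ℝ ∞ (fun u => (A u)⁻¹ i j) U := by
  have h : ∀ u, (A u)⁻¹ i j = ((A u).det)⁻¹ * ((A u).updateRow j (Pi.single i 1)).det := by
    intro u
    rw [inv_def, Matrix.smul_apply, adjugate_apply, Ring.inverse_eq_inv', smul_eq_mul]
  simp only [h]
  refine ((contDiffOn_det hA.smooth).inv fun u hu => (hA.isUnit_det u hu).ne_zero).mul
    (contDiffOn_det fun k l => ?_)
  by_cases hk : k = j
  · subst hk
    simpa using contDiffOn_const
  · simpa [updateRow_apply, hk] using hA.smooth k l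

theorem differentiableAt {u : E} (hu : u ∈ U) (i j : ι) :
    DifferentiableAt ℝ (fun v => A v i j) u :=
  differentiableAt_of_contDiffOn hA.isOpen (hA.smooth i j) hu

theorem mulVec_inv {u : E} (hu : u ∈ U) (X : ι → ℝ) (i : ι) :
    ∑ m, A u i m * ∑ l, (A u)⁻¹ m l * X l = X i := by
  have := congrFun (show A u *ᵥ ((A u)⁻¹ *ᵥ X) = X by
    rw [mulVec_mulVec, mul_nonsing_inv _ (hA.isUnit_det u hu), one_mulVec]) i
  simpa [mulVec, dotProduct] using this

theorem inv_mul_apply {u : E} (hu : u ∈ U) (i j : ι) :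
    ∑ k, (A u)⁻¹ i k * A u k j = if i = j then 1 else 0 := by
  have := congrFun (congrFun (nonsing_inv_mul (A u) (hA.isUnit_det u hu)) i) j
  rw [mul_apply, one_apply] at this
  exact this

theorem trace_inv_mul {u : E} (hu : u ∈ U) :
    ∑ i, ∑ j, (A u)⁻¹ i j * A u i j = Fintype.card ι := by
  have (i : ι) : ∑ j, (A u)⁻¹ i j * A u i j = 1 := by
    simpa [hA.symm u hu _ i] using hA.inv_mul_apply hu i i
  simp [this]

variable (b : Module.Basis ι ℝ E)

theorem pderiv_symm {u : E} (hu : u ∈ U) (l i j : ι) :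
    pderiv b l (fun v => A v i j) u = pderiv b l (fun v => A v j i) u :=
  pderiv_congr_of_eqOn b hA.isOpen (fun v hv => hA.symm v hv i j) hu l

theorem christoffel_symm {u : E} (hu : u ∈ U) (k i j : ι) :
    christoffel b A k i j u = christoffel b A k j i u := by
  simp only [christoffel]
  congr 1
  refine Finset.sum_congr rfl fun l _ => ?_
  rw [hA.pderiv_symm b hu l i j]
  ring

theorem smooth_christoffel (k i j : ι) : ContDiffOn ℝ ∞ (christoffel b A k i j) U := by
  unfold christoffel
  have h := fun l i j => contDiffOn_pderiv b hA.isOpen (hA.smooth i j) l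
  exact contDiffOn_const.mul (ContDiffOn.sum fun l _ =>
    (hA.smooth_inv k l).mul (((h _ _ _).add (h _ _ _)).sub (h _ _ _)))

/-- The Christoffel symbols of the first kind; they contain no inverse metric, so `pderiv_metric`
follows from them by linear algebra. -/
theorem lower_christoffel {u : E} (hu : u ∈ U) (k i j : ι) :
    ∑ m, A u k m * christoffel b A m i j u =
      (1 / 2) * (pderiv b i (fun v => A v j k) u + pderiv b j (fun v => A v i k) u
        - pderiv b k (fun v => A v i j) u) := by
  simp only [christoffel]
  rw [← hA.mulVec_inv hu (fun k => pderiv b i (fun v => A v j k) u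
    + pderiv b j (fun v => A v i k) u - pderiv b k (fun v => A v i j) u) k, Finset.mul_sum]
  exact Finset.sum_congr rfl fun m _ => by ring

/-- The metric is parallel. -/
theorem pderiv_metric {u : E} (hu : u ∈ U) (k i j : ι) :
    pderiv b k (fun v => A v i j) u =
      ∑ m, A u i m * christoffel b A m j k u + ∑ m, A u j m * christoffel b A m i k u := by
  rw [hA.lower_christoffel b hu, hA.lower_christoffel b hu, hA.pderiv_symm b hu k j i,
    hA.pderiv_symm b hu j k i, hA.pderiv_symm b hu i k j]
  ring

end IsMetricOn

end Metrics

/-! ### Block form of a warped metric -/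

section WarpedMatrix

variable {ι κ E E' : Type*} (A : E → Matrix ι ι ℝ) (φ : E → ℝ) (D : E' → Matrix κ κ ℝ)
  (z : E × E')

/-- The components of a warped product metric in product coordinates. -/
def warpedMatrix : Matrix (ι ⊕ κ) (ι ⊕ κ) ℝ :=
  fromBlocks (A z.1) 0 0 (φ z.1 • D z.2)

theorem warpedMatrix_ll (i j : ι) : warpedMatrix A φ D z (.inl i) (.inl j) = A z.1 i j := rfl

theorem warpedMatrix_lr (i : ι) (j : κ) : warpedMatrix A φ D z (.inl i) (.inr j) = 0 := rfl

theorem warpedMatrix_rl (i : κ) (j : ι) : warpedMatrix A φ D z (.inr i) (.inl j) = 0 := rfl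

theorem warpedMatrix_rr (i j : κ) :
    warpedMatrix A φ D z (.inr i) (.inr j) = φ z.1 * D z.2 i j := rfl

end WarpedMatrix

/-! ### Curvature of a warped product in coordinates -/

section WarpedCoordinates

variable {ι : Type*} [Fintype ι] [DecidableEq ι] {κ : Type*} [Fintype κ] [DecidableEq κ]
variable {E : Type*} [NormedAddCommGroup E] [NormedSpace ℝ E]
variable {E' : Type*} [NormedAddCommGroup E'] [NormedSpace ℝ E']

/-- The gradient `g^{kl} ∂_l F`. -/
def gradient (b : Module.Basis ι ℝ E) (A : E → Matrix ι ι ℝ) (F : E → ℝ) (k : ι) (u : E) : ℝ :=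
  ∑ l, (A u)⁻¹ k l * pderiv b l F u

/-- The logarithmic derivative of `√F`. -/
def sqrtLogDeriv (b : Module.Basis ι ℝ E) (F : E → ℝ) (a : ι) (u : E) : ℝ :=
  pderiv b a F u * (2 * F u)⁻¹

/-- The tensor `T_{ab}` of a warping function in coordinates. -/
def coordT (b : Module.Basis ι ℝ E) (A : E → Matrix ι ι ℝ) (φ : E → ℝ) (a c : ι) (u : E) : ℝ :=
  -(1 / (2 * φ u)) *
    (hessian b A φ a c u - 1 / (2 * φ u) * (pderiv b a φ u * pderiv b c φ u))

/-- The scalar `P` of a warping function in coordinates. -/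
def coordP (b : Module.Basis ι ℝ E) (A : E → Matrix ι ι ℝ) (φ : E → ℝ) (u : E) : ℝ :=
  1 / (4 * φ u ^ 2) * ∑ a, ∑ c, (A u)⁻¹ a c * (pderiv b a φ u * pderiv b c φ u)

/-- The scalar `Q` of a warping function in coordinates. -/
def coordQ (b : Module.Basis ι ℝ E) (A : E → Matrix ι ι ℝ) (φ : E → ℝ) (m : ℕ) (u : E) : ℝ :=
  φ u * (((m : ℝ) - 1) * coordP b A φ u - ∑ a, ∑ c, (A u)⁻¹ a c * coordT b A φ a c u)

/-- The coordinate data of a warped product over `U × V`. -/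
structure IsWarpedOn (U : Set E) (V : Set E') (A : E → Matrix ι ι ℝ) (φ : E → ℝ)
    (D : E' → Matrix κ κ ℝ) : Prop where
  base : IsMetricOn U A
  fiber : IsMetricOn V D
  smooth : ContDiffOn ℝ ∞ φ U
  ne_zero : ∀ u ∈ U, φ u ≠ 0

theorem riemann_antisymm (b : Module.Basis ι ℝ E) (A : E → Matrix ι ι ℝ) (h i j k : ι) (u : E) :
    riemann b A h i k j u = -riemann b A h i j k u := by
  simp only [riemann, ← Finset.sum_neg_distrib, ← mul_neg]
  refine Finset.sum_congr rfl fun l _ => ?_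
  rw [neg_add, ← Finset.sum_neg_distrib]
  congr 1
  congr 1
  · ring
  · exact Finset.sum_congr rfl fun m _ => by ring

namespace IsWarpedOn

variable (b : Module.Basis ι ℝ E) (b' : Module.Basis κ ℝ E')
variable {U : Set E} {V : Set E'} {A : E → Matrix ι ι ℝ} {φ : E → ℝ} {D : E' → Matrix κ κ ℝ}

variable (W : IsWarpedOn U V A φ D)
include W

theorem isOpen : IsOpen (U ×ˢ V) := W.base.isOpen.prod W.fiber.isOpen

theorem differentiableAt {u : E} (hu : u ∈ U) : DifferentiableAt ℝ φ u :=
  differentiableAt_of_contDiffOn W.base.isOpen W.smooth hu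

theorem smooth_gradient (k : ι) : ContDiffOn ℝ ∞ (gradient b A φ k) U :=
  ContDiffOn.sum fun l _ =>
    (W.base.smooth_inv k l).mul (contDiffOn_pderiv b W.base.isOpen W.smooth l)

theorem smooth_sqrtLogDeriv (a : ι) : ContDiffOn ℝ ∞ (sqrtLogDeriv b φ a) U :=
  (contDiffOn_pderiv b W.base.isOpen W.smooth a).mul
    ((contDiffOn_const.mul W.smooth).inv fun u hu => mul_ne_zero two_ne_zero (W.ne_zero u hu))

variable {z : E × E'} (hz : z ∈ U ×ˢ V)

/-! ### Inverse metric, Christoffel symbols and their derivatives, block by block -/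

section FirstOrder

include hz

theorem inv_warpedMatrix :
    (warpedMatrix A φ D z)⁻¹ = fromBlocks (A z.1)⁻¹ 0 0 ((φ z.1)⁻¹ • (D z.2)⁻¹) := by
  apply inv_eq_right_inv
  rw [warpedMatrix, fromBlocks_multiply]
  simp [mul_nonsing_inv _ (W.base.isUnit_det _ hz.1), mul_nonsing_inv _ (W.fiber.isUnit_det _ hz.2),
    smul_smul, inv_mul_cancel₀ (W.ne_zero _ hz.1)]

theorem inv_ll (i j : ι) : (warpedMatrix A φ D z)⁻¹ (.inl i) (.inl j) = (A z.1)⁻¹ i j := by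
  rw [W.inv_warpedMatrix hz]; rfl

theorem inv_lr (i : ι) (j : κ) : (warpedMatrix A φ D z)⁻¹ (.inl i) (.inr j) = 0 := by
  rw [W.inv_warpedMatrix hz]; rfl

theorem inv_rl (i : κ) (j : ι) : (warpedMatrix A φ D z)⁻¹ (.inr i) (.inl j) = 0 := by
  rw [W.inv_warpedMatrix hz]; rfl

theorem inv_rr (i j : κ) :
    (warpedMatrix A φ D z)⁻¹ (.inr i) (.inr j) = (φ z.1)⁻¹ * (D z.2)⁻¹ i j := by
  rw [W.inv_warpedMatrix hz]; rfl

theorem pderiv_base_l (k i j : ι) :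
    pderiv (b.prod b') (.inl k) (fun w => A w.1 i j) z = pderiv b k (fun v => A v i j) z.1 :=
  pderiv_fst_inl b b' (F := fun v => A v i j) (W.base.differentiableAt hz.1 i j) k

theorem pderiv_base_r (k : κ) (i j : ι) :
    pderiv (b.prod b') (.inr k) (fun w => A w.1 i j) z = 0 :=
  pderiv_fst_inr b b' (F := fun v => A v i j) (W.base.differentiableAt hz.1 i j) k

theorem pderiv_fiber_l (k : ι) (i j : κ) :
    pderiv (b.prod b') (.inl k) (fun w => φ w.1 * D w.2 i j) z = pderiv b k φ z.1 * D z.2 i j :=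
  pderiv_prod_mul_inl b b' (K := fun v => D v i j) (W.differentiableAt hz.1)
    (W.fiber.differentiableAt hz.2 i j) k

theorem pderiv_fiber_r (k i j : κ) :
    pderiv (b.prod b') (.inr k) (fun w => φ w.1 * D w.2 i j) z =
      φ z.1 * pderiv b' k (fun v => D v i j) z.2 :=
  pderiv_prod_mul_inr b b' (K := fun v => D v i j) (W.differentiableAt hz.1)
    (W.fiber.differentiableAt hz.2 i j) k

/-- In the names, `l` marks a base index and `r` a fiber index, in the order of the arguments; for
Christoffel symbols the upper index comes first. -/
theorem christoffel_lll (k i j : ι) :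
    christoffel (b.prod b') (warpedMatrix A φ D) (.inl k) (.inl i) (.inl j) z =
      christoffel b A k i j z.1 := by
  simp only [christoffel, Fintype.sum_sum_type, W.inv_ll hz, W.inv_lr hz, warpedMatrix_ll,
    W.pderiv_base_l b b' hz, zero_mul, Finset.sum_const_zero, add_zero]

theorem christoffel_llr (k i : ι) (j : κ) :
    christoffel (b.prod b') (warpedMatrix A φ D) (.inl k) (.inl i) (.inr j) z = 0 := by
  simp [christoffel, Fintype.sum_sum_type, W.inv_ll hz, W.inv_lr hz, warpedMatrix_ll,
    warpedMatrix_lr, warpedMatrix_rl, W.pderiv_base_r b b' hz]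

theorem christoffel_lrl (k : ι) (i : κ) (j : ι) :
    christoffel (b.prod b') (warpedMatrix A φ D) (.inl k) (.inr i) (.inl j) z = 0 := by
  simp [christoffel, Fintype.sum_sum_type, W.inv_ll hz, W.inv_lr hz, warpedMatrix_ll,
    warpedMatrix_lr, warpedMatrix_rl, W.pderiv_base_r b b' hz]

theorem christoffel_lrr (k : ι) (i j : κ) :
    christoffel (b.prod b') (warpedMatrix A φ D) (.inl k) (.inr i) (.inr j) z =
      -(1 / 2) * gradient b A φ k z.1 * D z.2 i j := by
  simp only [christoffel, Fintype.sum_sum_type, W.inv_ll hz, W.inv_lr hz, warpedMatrix_rr,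
    warpedMatrix_rl, pderiv_const, W.pderiv_fiber_l b b' hz, zero_mul, Finset.sum_const_zero,
    gradient, add_zero, zero_sub, Finset.mul_sum, Finset.sum_mul]
  exact Finset.sum_congr rfl fun l _ => by ring

theorem christoffel_rll (k : κ) (i j : ι) :
    christoffel (b.prod b') (warpedMatrix A φ D) (.inr k) (.inl i) (.inl j) z = 0 := by
  simp [christoffel, Fintype.sum_sum_type, W.inv_rl hz, warpedMatrix_ll,
    warpedMatrix_lr, W.pderiv_base_r b b' hz]

theorem christoffel_rlr (k : κ) (i : ι) (j : κ) :
    christoffel (b.prod b') (warpedMatrix A φ D) (.inr k) (.inl i) (.inr j) z =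
      sqrtLogDeriv b φ i z.1 * (if k = j then 1 else 0) := by
  simp only [christoffel, Fintype.sum_sum_type, W.inv_rr hz, W.inv_rl hz, warpedMatrix_rr,
    warpedMatrix_lr, pderiv_const, W.pderiv_fiber_l b b' hz, zero_mul, Finset.sum_const_zero,
    add_zero, zero_add, sub_zero]
  have h0 := W.ne_zero _ hz.1
  -- The Kronecker delta is expanded as inverse metric times metric, so that the two sums agree term
  -- by term; the factor `φ⁻¹` of the inverse metric turns `∂φ / 2` into `sqrtLogDeriv`.
  rw [← W.fiber.inv_mul_apply hz.2, Finset.mul_sum, Finset.mul_sum]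
  refine Finset.sum_congr rfl fun l _ => ?_
  rw [sqrtLogDeriv, W.fiber.symm _ hz.2 j l]
  field_simp

theorem christoffel_rrl (k i : κ) (j : ι) :
    christoffel (b.prod b') (warpedMatrix A φ D) (.inr k) (.inr i) (.inl j) z =
      sqrtLogDeriv b φ j z.1 * (if k = i then 1 else 0) := by
  rw [← W.christoffel_rlr b b' hz]
  simp only [christoffel, Fintype.sum_sum_type, W.inv_rr hz, W.inv_rl hz, warpedMatrix_rr,
    warpedMatrix_lr, warpedMatrix_rl, pderiv_const, W.pderiv_fiber_l b b' hz, zero_mul,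
    Finset.sum_const_zero, add_zero, zero_add, sub_zero]

theorem christoffel_rrr (k i j : κ) :
    christoffel (b.prod b') (warpedMatrix A φ D) (.inr k) (.inr i) (.inr j) z =
      christoffel b' D k i j z.2 := by
  have h0 := W.ne_zero _ hz.1
  simp only [christoffel, Fintype.sum_sum_type, W.inv_rr hz, W.inv_rl hz, warpedMatrix_rr,
    W.pderiv_fiber_r b b' hz, zero_mul, Finset.sum_const_zero, zero_add]
  congr 1
  refine Finset.sum_congr rfl fun l _ => ?_
  field_simp

/-- Each formula for a Christoffel block holds on the whole open set `U ×ˢ V`, not just at `z`, and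
may therefore be differentiated. -/
theorem pderiv_christoffel_lll_l (c k i j : ι) :
    pderiv (b.prod b') (.inl c)
        (christoffel (b.prod b') (warpedMatrix A φ D) (.inl k) (.inl i) (.inl j)) z =
      pderiv b c (christoffel b A k i j) z.1 := by
  rw [pderiv_congr_of_eqOn _ W.isOpen (fun w hw => W.christoffel_lll b b' hw k i j) hz]
  exact pderiv_fst_inl b b'
    (differentiableAt_of_contDiffOn W.base.isOpen (W.base.smooth_christoffel b k i j) hz.1) c

theorem pderiv_christoffel_lll_r (c : κ) (k i j : ι) :
    pderiv (b.prod b') (.inr c)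
        (christoffel (b.prod b') (warpedMatrix A φ D) (.inl k) (.inl i) (.inl j)) z = 0 := by
  rw [pderiv_congr_of_eqOn _ W.isOpen (fun w hw => W.christoffel_lll b b' hw k i j) hz]
  exact pderiv_fst_inr b b'
    (differentiableAt_of_contDiffOn W.base.isOpen (W.base.smooth_christoffel b k i j) hz.1) c

theorem pderiv_christoffel_llr (c : ι ⊕ κ) (k i : ι) (j : κ) :
    pderiv (b.prod b') c
        (christoffel (b.prod b') (warpedMatrix A φ D) (.inl k) (.inl i) (.inr j)) z = 0 := by
  rw [pderiv_congr_of_eqOn _ W.isOpen (fun w hw => W.christoffel_llr b b' hw k i j) hz,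
    pderiv_const]

theorem pderiv_christoffel_lrl (c : ι ⊕ κ) (k : ι) (i : κ) (j : ι) :
    pderiv (b.prod b') c
        (christoffel (b.prod b') (warpedMatrix A φ D) (.inl k) (.inr i) (.inl j)) z = 0 := by
  rw [pderiv_congr_of_eqOn _ W.isOpen (fun w hw => W.christoffel_lrl b b' hw k i j) hz,
    pderiv_const]

theorem pderiv_christoffel_rll (c : ι ⊕ κ) (k : κ) (i j : ι) :
    pderiv (b.prod b') c
        (christoffel (b.prod b') (warpedMatrix A φ D) (.inr k) (.inl i) (.inl j)) z = 0 := by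
  rw [pderiv_congr_of_eqOn _ W.isOpen (fun w hw => W.christoffel_rll b b' hw k i j) hz,
    pderiv_const]

theorem differentiableAt_gradient (k : ι) : DifferentiableAt ℝ (gradient b A φ k) z.1 :=
  differentiableAt_of_contDiffOn W.base.isOpen (W.smooth_gradient b k) hz.1

theorem differentiableAt_sqrtLogDeriv (a : ι) : DifferentiableAt ℝ (sqrtLogDeriv b φ a) z.1 :=
  differentiableAt_of_contDiffOn W.base.isOpen (W.smooth_sqrtLogDeriv b a) hz.1

theorem pderiv_christoffel_lrr_l (c k : ι) (i j : κ) :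
    pderiv (b.prod b') (.inl c)
        (christoffel (b.prod b') (warpedMatrix A φ D) (.inl k) (.inr i) (.inr j)) z =
      -(1 / 2) * pderiv b c (gradient b A φ k) z.1 * D z.2 i j := by
  have hd := W.differentiableAt_gradient b hz k
  rw [pderiv_congr_of_eqOn _ W.isOpen (fun w hw => W.christoffel_lrr b b' hw k i j) hz,
    pderiv_prod_mul_inl b b' (F := fun v => -(1 / 2) * gradient b A φ k v) (K := fun v => D v i j)
      (hd.const_mul _) (W.fiber.differentiableAt hz.2 i j), pderiv_const_mul b hd]

theorem pderiv_christoffel_lrr_r (c : κ) (k : ι) (i j : κ) :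
    pderiv (b.prod b') (.inr c)
        (christoffel (b.prod b') (warpedMatrix A φ D) (.inl k) (.inr i) (.inr j)) z =
      -(1 / 2) * gradient b A φ k z.1 * pderiv b' c (fun v => D v i j) z.2 := by
  have hd := W.differentiableAt_gradient b hz k
  rw [pderiv_congr_of_eqOn _ W.isOpen (fun w hw => W.christoffel_lrr b b' hw k i j) hz,
    pderiv_prod_mul_inr b b' (F := fun v => -(1 / 2) * gradient b A φ k v) (K := fun v => D v i j)
      (hd.const_mul _) (W.fiber.differentiableAt hz.2 i j)]

theorem pderiv_christoffel_rlr_l (c : ι) (k : κ) (i : ι) (j : κ) :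
    pderiv (b.prod b') (.inl c)
        (christoffel (b.prod b') (warpedMatrix A φ D) (.inr k) (.inl i) (.inr j)) z =
      pderiv b c (sqrtLogDeriv b φ i) z.1 * (if k = j then 1 else 0) := by
  rw [pderiv_congr_of_eqOn _ W.isOpen (fun w hw => W.christoffel_rlr b b' hw k i j) hz]
  exact pderiv_prod_mul_inl b b' (K := fun _ => if k = j then 1 else 0)
      (W.differentiableAt_sqrtLogDeriv b hz i) (differentiableAt_const _) c

theorem pderiv_christoffel_rlr_r (c k : κ) (i : ι) (j : κ) :
    pderiv (b.prod b') (.inr c)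
        (christoffel (b.prod b') (warpedMatrix A φ D) (.inr k) (.inl i) (.inr j)) z = 0 := by
  rw [pderiv_congr_of_eqOn _ W.isOpen (fun w hw => W.christoffel_rlr b b' hw k i j) hz]
  rw [pderiv_prod_mul_inr b b' (K := fun _ => if k = j then 1 else 0)
      (W.differentiableAt_sqrtLogDeriv b hz i) (differentiableAt_const _) c, pderiv_const, mul_zero]

theorem pderiv_christoffel_rrl_l (c : ι) (k i : κ) (j : ι) :
    pderiv (b.prod b') (.inl c)
        (christoffel (b.prod b') (warpedMatrix A φ D) (.inr k) (.inr i) (.inl j)) z =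
      pderiv b c (sqrtLogDeriv b φ j) z.1 * (if k = i then 1 else 0) := by
  rw [pderiv_congr_of_eqOn _ W.isOpen (fun w hw => W.christoffel_rrl b b' hw k i j) hz]
  exact pderiv_prod_mul_inl b b' (K := fun _ => if k = i then 1 else 0)
      (W.differentiableAt_sqrtLogDeriv b hz j) (differentiableAt_const _) c

theorem pderiv_christoffel_rrl_r (c k i : κ) (j : ι) :
    pderiv (b.prod b') (.inr c)
        (christoffel (b.prod b') (warpedMatrix A φ D) (.inr k) (.inr i) (.inl j)) z = 0 := by
  rw [pderiv_congr_of_eqOn _ W.isOpen (fun w hw => W.christoffel_rrl b b' hw k i j) hz]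
  rw [pderiv_prod_mul_inr b b' (K := fun _ => if k = i then 1 else 0)
      (W.differentiableAt_sqrtLogDeriv b hz j) (differentiableAt_const _) c, pderiv_const, mul_zero]

theorem pderiv_christoffel_rrr_l (c : ι) (k i j : κ) :
    pderiv (b.prod b') (.inl c)
        (christoffel (b.prod b') (warpedMatrix A φ D) (.inr k) (.inr i) (.inr j)) z = 0 := by
  rw [pderiv_congr_of_eqOn _ W.isOpen (fun w hw => W.christoffel_rrr b b' hw k i j) hz]
  exact pderiv_snd_inl b b'
    (differentiableAt_of_contDiffOn W.fiber.isOpen (W.fiber.smooth_christoffel b' k i j) hz.2) c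

theorem pderiv_christoffel_rrr_r (c k i j : κ) :
    pderiv (b.prod b') (.inr c)
        (christoffel (b.prod b') (warpedMatrix A φ D) (.inr k) (.inr i) (.inr j)) z =
      pderiv b' c (christoffel b' D k i j) z.2 := by
  rw [pderiv_congr_of_eqOn _ W.isOpen (fun w hw => W.christoffel_rrr b b' hw k i j) hz]
  exact pderiv_snd_inr b b'
    (differentiableAt_of_contDiffOn W.fiber.isOpen (W.fiber.smooth_christoffel b' k i j) hz.2) c

end FirstOrder

end IsWarpedOn

end WarpedCoordinates

/-! ### Riemann tensor of a warped product -/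

section WarpedCurvature

variable {ι : Type*} [Fintype ι] [DecidableEq ι] {κ : Type*} [Fintype κ] [DecidableEq κ]
variable {E : Type*} [NormedAddCommGroup E] [NormedSpace ℝ E]
variable {E' : Type*} [NormedAddCommGroup E'] [NormedSpace ℝ E']

namespace IsWarpedOn

variable (b : Module.Basis ι ℝ E) (b' : Module.Basis κ ℝ E')
variable {U : Set E} {V : Set E'} {A : E → Matrix ι ι ℝ} {φ : E → ℝ} {D : E' → Matrix κ κ ℝ}

variable (W : IsWarpedOn U V A φ D)
include W

theorem lower_gradient {u : E} (hu : u ∈ U) (a : ι) :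
    ∑ c, A u a c * gradient b A φ c u = pderiv b a φ u :=
  W.base.mulVec_inv hu (fun l => pderiv b l φ u) a

/-- Lowering an index commutes with covariant differentiation: differentiate `∂_a φ = A_{ad} (grad
φ)^d` and expand the derivative of `A` by `pderiv_metric`. One of the two resulting Christoffel
terms completes the covariant derivative of the gradient, the other is the correction term in the
Hessian. -/
theorem lower_covDeriv_gradient {u : E} (hu : u ∈ U) (a c : ι) :
    ∑ d, A u a d * (pderiv b c (gradient b A φ d) u
      + ∑ m, christoffel b A d m c u * gradient b A φ m u) = hessian b A φ a c u := by
  have hg : ∀ d, DifferentiableAt ℝ (gradient b A φ d) u := fun d =>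
    differentiableAt_of_contDiffOn W.base.isOpen (W.smooth_gradient b d) hu
  have h1 : pderiv b c (pderiv b a φ) u = ∑ d, (A u a d * pderiv b c (gradient b A φ d) u
      + pderiv b c (fun v => A v a d) u * gradient b A φ d u) := by
    rw [pderiv_congr_of_eqOn b W.base.isOpen (fun v hv => (W.lower_gradient b hv a).symm) hu,
      pderiv_sum b _ fun d _ => (W.base.differentiableAt hu a d).fun_mul (hg d)]
    exact Finset.sum_congr rfl fun d _ => pderiv_mul b (W.base.differentiableAt hu a d) (hg d) c
  have h2 : ∑ d, pderiv b c (fun v => A v a d) u * gradient b A φ d u =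
      ∑ d, A u a d * ∑ m, christoffel b A d m c u * gradient b A φ m u
        + ∑ d, christoffel b A d c a u * pderiv b d φ u := by
    have h3 : ∀ m, christoffel b A m c a u * pderiv b m φ u =
        ∑ d, A u d m * christoffel b A m a c u * gradient b A φ d u := by
      intro m
      rw [← W.lower_gradient b hu, Finset.mul_sum]
      refine Finset.sum_congr rfl fun d _ => ?_
      rw [W.base.symm u hu m d, W.base.christoffel_symm b hu m c a]
      ring
    simp only [h3, W.base.pderiv_metric b hu, add_mul, Finset.sum_add_distrib, Finset.sum_mul,
      Finset.mul_sum]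
    rw [Finset.sum_comm]
    congr 1
    · simp only [mul_assoc]
    · rw [Finset.sum_comm]
  rw [hessian, h1, Finset.sum_add_distrib, h2]
  simp only [mul_add, Finset.sum_add_distrib]
  ring

theorem hessian_eq {u : E} (hu : u ∈ U) (a c : ι) :
    hessian b A φ a c u = -2 * φ u * coordT b A φ a c u
      + sqrtLogDeriv b φ c u * pderiv b a φ u := by
  have h0 := W.ne_zero u hu
  rw [coordT, sqrtLogDeriv]
  field_simp
  ring

/-- The contraction that produces `P` in `riemann_rrrr`, where two fiber directions interact through
a summed base index. -/
theorem sum_gradient_mul_sqrtLogDeriv {u : E} (hu : u ∈ U) :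
    ∑ x, 2⁻¹ * gradient b A φ x u * sqrtLogDeriv b φ x u = φ u * coordP b A φ u := by
  have h0 := W.ne_zero u hu
  rw [coordP, ← mul_assoc, Finset.mul_sum]
  refine Finset.sum_congr rfl fun a _ => ?_
  simp only [gradient, sqrtLogDeriv, Finset.mul_sum, Finset.sum_mul]
  refine Finset.sum_congr rfl fun c _ => ?_
  field_simp
  ring

theorem pderiv_sqrtLogDeriv {u : E} (hu : u ∈ U) (a c : ι) :
    pderiv b c (sqrtLogDeriv b φ a) u = (2 * φ u)⁻¹ * pderiv b c (pderiv b a φ) u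
      - 2 * sqrtLogDeriv b φ a u * sqrtLogDeriv b φ c u := by
  have h0 := W.ne_zero u hu
  have hd := W.differentiableAt hu
  have hp := differentiableAt_of_contDiffOn W.base.isOpen
    (contDiffOn_pderiv b W.base.isOpen W.smooth a) hu
  have h2 : DifferentiableAt ℝ (fun v => 2 * φ v) u := hd.const_mul 2
  unfold sqrtLogDeriv
  rw [pderiv_mul b hp (h2.fun_inv (by simpa using h0)), pderiv_inv b h2 (by simpa using h0),
    pderiv_const_mul b hd]
  field_simp
  ring

theorem pderiv_sqrtLogDeriv_comm {u : E} (hu : u ∈ U) (a c : ι) :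
    pderiv b c (sqrtLogDeriv b φ a) u = pderiv b a (sqrtLogDeriv b φ c) u := by
  rw [W.pderiv_sqrtLogDeriv b hu, W.pderiv_sqrtLogDeriv b hu,
    pderiv_comm b W.base.isOpen W.smooth hu]
  ring

variable {z : E × E'} (hz : z ∈ U ×ˢ V)
include hz

theorem riemann_llll (h i j k : ι) :
    riemann (b.prod b') (warpedMatrix A φ D) (.inl h) (.inl i) (.inl j) (.inl k) z =
      riemann b A h i j k z.1 := by
  simp [riemann, Fintype.sum_sum_type, warpedMatrix_ll, warpedMatrix_lr,
    W.christoffel_lll b b' hz, W.christoffel_rll b b' hz, W.pderiv_christoffel_lll_l b b' hz]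

theorem riemann_lllr (h i j : ι) (k : κ) :
    riemann (b.prod b') (warpedMatrix A φ D) (.inl h) (.inl i) (.inl j) (.inr k) z = 0 := by
  simp [riemann, Fintype.sum_sum_type, warpedMatrix_ll, warpedMatrix_lr,
    W.christoffel_lll b b' hz, W.christoffel_llr b b' hz, W.christoffel_lrl b b' hz,
    W.christoffel_rll b b' hz, W.pderiv_christoffel_lll_r b b' hz,
    W.pderiv_christoffel_llr b b' hz]

theorem riemann_llrr (h i : ι) (j k : κ) :
    riemann (b.prod b') (warpedMatrix A φ D) (.inl h) (.inl i) (.inr j) (.inr k) z = 0 := by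
  simp [riemann, Fintype.sum_sum_type, warpedMatrix_ll, warpedMatrix_lr,
    W.christoffel_llr b b' hz, W.christoffel_rlr b b' hz, W.christoffel_lrr b b' hz,
    W.pderiv_christoffel_llr b b' hz, W.fiber.symm _ hz.2 j k]

theorem riemann_lrll (h : ι) (i : κ) (j k : ι) :
    riemann (b.prod b') (warpedMatrix A φ D) (.inl h) (.inr i) (.inl j) (.inl k) z = 0 := by
  simp [riemann, Fintype.sum_sum_type, warpedMatrix_ll, warpedMatrix_lr,
    W.christoffel_lrl b b' hz, W.pderiv_christoffel_lrl b b' hz]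

theorem riemann_lrrl (h : ι) (i j : κ) (k : ι) :
    riemann (b.prod b') (warpedMatrix A φ D) (.inl h) (.inr i) (.inr j) (.inl k) z =
      -φ z.1 * coordT b A φ h k z.1 * D z.2 i j := by
  simp [riemann, Fintype.sum_sum_type, warpedMatrix_ll, warpedMatrix_lr,
    W.christoffel_lll b b' hz, W.christoffel_lrl b b' hz, W.christoffel_lrr b b' hz,
    W.christoffel_rrl b b' hz, W.pderiv_christoffel_lrl b b' hz,
    W.pderiv_christoffel_lrr_l b b' hz]
  -- By `hessian_eq`, `-f T` is half of the Hessian minus `s_k ∂_h f`. Writing both terms as lowered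
  -- gradients lets the two sides be compared summand by summand.
  rw [show -(φ z.1 * coordT b A φ h k z.1 * D z.2 i j) = 2⁻¹ * D z.2 i j *
    (hessian b A φ h k z.1 - sqrtLogDeriv b φ k z.1 * pderiv b h φ z.1) by
      rw [W.hessian_eq b hz.1]; ring, ← W.lower_covDeriv_gradient b hz.1,
      ← W.lower_gradient b hz.1, Finset.mul_sum, ← Finset.sum_sub_distrib, Finset.mul_sum]
  refine Finset.sum_congr rfl fun d _ => ?_
  have : ∑ x, 2⁻¹ * gradient b A φ x z.1 * D z.2 i j * christoffel b A d x k z.1 =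
      2⁻¹ * D z.2 i j * ∑ m, christoffel b A d m k z.1 * gradient b A φ m z.1 := by
    rw [Finset.mul_sum]
    exact Finset.sum_congr rfl fun m _ => by ring
  rw [this]
  ring

/-- The block is a multiple of `∇_j D_{ik} - ∇_k D_{ij}`, which vanishes because the fiber metric is
parallel. -/
theorem riemann_lrrr (h : ι) (i j k : κ) :
    riemann (b.prod b') (warpedMatrix A φ D) (.inl h) (.inr i) (.inr j) (.inr k) z = 0 := by
  simp [riemann, Fintype.sum_sum_type, warpedMatrix_ll, warpedMatrix_lr,
    W.christoffel_llr b b' hz, W.christoffel_lrr b b' hz, W.christoffel_rrr b b' hz,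
    W.pderiv_christoffel_lrr_r b b' hz, W.fiber.pderiv_metric b' hz.2]
  refine Finset.sum_eq_zero fun d _ => ?_
  have (j k : κ) : ∑ x, christoffel b' D x i k z.2 * (2⁻¹ * gradient b A φ d z.1 * D z.2 x j) =
      2⁻¹ * gradient b A φ d z.1 * ∑ m, D z.2 j m * christoffel b' D m i k z.2 := by
    rw [Finset.mul_sum]
    exact Finset.sum_congr rfl fun m _ => by rw [W.fiber.symm _ hz.2 m j]; ring
  simp only [this, W.fiber.christoffel_symm b' hz.2 _ k j]
  ring

theorem riemann_rlll (h : κ) (i j k : ι) :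
    riemann (b.prod b') (warpedMatrix A φ D) (.inr h) (.inl i) (.inl j) (.inl k) z = 0 := by
  simp [riemann, Fintype.sum_sum_type, warpedMatrix_rl, warpedMatrix_rr,
    W.christoffel_rll b b' hz, W.pderiv_christoffel_rll b b' hz]

theorem riemann_rllr (h : κ) (i j : ι) (k : κ) :
    riemann (b.prod b') (warpedMatrix A φ D) (.inr h) (.inl i) (.inl j) (.inr k) z =
      -φ z.1 * coordT b A φ i j z.1 * D z.2 h k := by
  simp [riemann, Fintype.sum_sum_type, warpedMatrix_rl, warpedMatrix_rr,
    W.christoffel_lll b b' hz, W.christoffel_llr b b' hz, W.christoffel_rll b b' hz,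
    W.christoffel_rlr b b' hz,
    W.christoffel_rrl b b' hz, W.pderiv_christoffel_rll b b' hz,
    W.pderiv_christoffel_rlr_l b b' hz]
  -- With `s = d log √|φ|`, the left side is `∇_j s_i + s_i s_j = ∇²√|φ| / √|φ|`, that is, `-T`.
  have key : pderiv b j (sqrtLogDeriv b φ i) z.1
      + sqrtLogDeriv b φ i z.1 * sqrtLogDeriv b φ j z.1
      - ∑ x, christoffel b A x i j z.1 * sqrtLogDeriv b φ x z.1 = -coordT b A φ i j z.1 := by
    have h0 := W.ne_zero _ hz.1
    have h1 : ∑ x, christoffel b A x i j z.1 * sqrtLogDeriv b φ x z.1 =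
        (2 * φ z.1)⁻¹ * ∑ d, christoffel b A d j i z.1 * pderiv b d φ z.1 := by
      rw [Finset.mul_sum]
      refine Finset.sum_congr rfl fun m _ => ?_
      rw [W.base.christoffel_symm b hz.1 m j i, sqrtLogDeriv]
      ring
    rw [h1, W.pderiv_sqrtLogDeriv b hz.1, coordT, hessian]
    simp only [sqrtLogDeriv]
    field_simp
    ring
  rw [Finset.sum_eq_single k (fun d _ hd => by simp [hd]) (by simp)]
  simp only [if_true]
  linear_combination φ z.1 * D z.2 h k * key

theorem riemann_rlrr (h : κ) (i : ι) (j k : κ) :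
    riemann (b.prod b') (warpedMatrix A φ D) (.inr h) (.inl i) (.inr j) (.inr k) z = 0 := by
  simp [riemann, Fintype.sum_sum_type, warpedMatrix_rl, warpedMatrix_rr,
    W.christoffel_llr b b' hz, W.christoffel_rlr b b' hz, W.christoffel_rrr b b' hz,
    W.pderiv_christoffel_rlr_r b b' hz]
  exact Finset.sum_eq_zero fun d _ => by
    rw [W.fiber.christoffel_symm b' hz.2 _ k j, sub_self, mul_zero]

/-- The derivative terms cancel because `s` is closed; the quadratic terms `s_j s_k` cancel by
commutativity. -/
theorem riemann_rrll (h i : κ) (j k : ι) :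
    riemann (b.prod b') (warpedMatrix A φ D) (.inr h) (.inr i) (.inl j) (.inl k) z = 0 := by
  simp [riemann, Fintype.sum_sum_type, warpedMatrix_rl, warpedMatrix_rr,
    W.christoffel_lrl b b' hz, W.christoffel_rrl b b' hz,
    W.pderiv_christoffel_rrl_l b b' hz]
  exact Finset.sum_eq_zero fun d _ => by
    rw [W.pderiv_sqrtLogDeriv_comm b hz.1, mul_comm (sqrtLogDeriv b φ k z.1), sub_self, sub_self,
      add_zero, mul_zero]

theorem riemann_rrlr (h i : κ) (j : ι) (k : κ) :
    riemann (b.prod b') (warpedMatrix A φ D) (.inr h) (.inr i) (.inl j) (.inr k) z = 0 := by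
  simp [riemann, Fintype.sum_sum_type, warpedMatrix_rl, warpedMatrix_rr,
    W.christoffel_lrl b b' hz, W.christoffel_lrr b b' hz, W.christoffel_rll b b' hz,
    W.christoffel_rrl b b' hz,
    W.christoffel_rrr b b' hz, W.pderiv_christoffel_rrl_r b b' hz,
    W.pderiv_christoffel_rrr_l b b' hz]
  exact Finset.sum_eq_zero fun d _ => by ring

theorem riemann_rrrr (h i j k : κ) :
    riemann (b.prod b') (warpedMatrix A φ D) (.inr h) (.inr i) (.inr j) (.inr k) z =
      φ z.1 * riemann b' D h i j k z.2 + φ z.1 ^ 2 * coordP b A φ z.1 *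
        (D z.2 h k * D z.2 i j - D z.2 h j * D z.2 i k) := by
  simp [riemann, Fintype.sum_sum_type, warpedMatrix_rl, warpedMatrix_rr,
    W.christoffel_lrr b b' hz, W.christoffel_rlr b b' hz,
    W.christoffel_rrr b b' hz, W.pderiv_christoffel_rrr_r b b' hz]
  have key (c : ℝ) : ∑ x, 2⁻¹ * gradient b A φ x z.1 * c * sqrtLogDeriv b φ x z.1 =
      c * (φ z.1 * coordP b A φ z.1) := by
    rw [← W.sum_gradient_mul_sqrtLogDeriv b hz.1, Finset.mul_sum]
    exact Finset.sum_congr rfl fun m _ => by ring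
  simp only [key]
  -- The `P` term is spread over a sum with Kronecker deltas, to match the sum that lowers the first
  -- curvature index.
  rw [show φ z.1 ^ 2 * coordP b A φ z.1 * (D z.2 h k * D z.2 i j - D z.2 h j * D z.2 i k) =
    ∑ d, φ z.1 ^ 2 * coordP b A φ z.1 * (D z.2 h d * (if d = k then D z.2 i j else 0)
      - D z.2 h d * (if d = j then D z.2 i k else 0)) by
        rw [← Finset.mul_sum, Finset.sum_sub_distrib]; simp,
    Finset.mul_sum, ← Finset.sum_add_distrib]
  refine Finset.sum_congr rfl fun d _ => ?_
  split_ifs <;> ring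

end IsWarpedOn
end WarpedCurvature

/-! ### Locality of the curvature -/

section Congruence

variable {ι : Type*} [Fintype ι] [DecidableEq ι]
variable {E : Type*} [NormedAddCommGroup E] [NormedSpace ℝ E]
variable (b : Module.Basis ι ℝ E) {U : Set E} (hU : IsOpen U) {G G' : E → Matrix ι ι ℝ}
  (h : Set.EqOn G G' U)
include hU h

/-- The components of the warped metric are known to be block diagonal only over the chart target;
openness of the set is what makes the derivatives agree there too. -/
theorem christoffel_congr (k i j : ι) :
    Set.EqOn (christoffel b G k i j) (christoffel b G' k i j) U := by
  intro u hu
  have hd (l i j : ι) : pderiv b l (fun v => G v i j) u = pderiv b l (fun v => G' v i j) u :=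
    pderiv_congr_of_eqOn b hU (fun v hv => by simp only [h hv]) hu l
  simp only [christoffel, hd, h hu]

theorem riemann_congr {u : E} (hu : u ∈ U) (i j k l : ι) :
    riemann b G i j k l u = riemann b G' i j k l u := by
  have hc (k i j : ι) := christoffel_congr b hU h k i j hu
  have hd (l k i j : ι) := pderiv_congr_of_eqOn b hU (christoffel_congr b hU h k i j) hu l
  simp only [riemann, h hu, hc, hd]

theorem ricci_congr {u : E} (hu : u ∈ U) (j k : ι) : ricci b G j k u = ricci b G' j k u := by
  simp only [ricci, h hu, riemann_congr b hU h hu]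

end Congruence

/-! ### Ricci tensor of a warped product and the Roter equation -/

section WarpedRicci

variable {ι : Type*} [Fintype ι] [DecidableEq ι] {κ : Type*} [Fintype κ] [DecidableEq κ]
variable {E : Type*} [NormedAddCommGroup E] [NormedSpace ℝ E]
variable {E' : Type*} [NormedAddCommGroup E'] [NormedSpace ℝ E']

namespace IsWarpedOn

variable (b : Module.Basis ι ℝ E) (b' : Module.Basis κ ℝ E')
variable {U : Set E} {V : Set E'} {A : E → Matrix ι ι ℝ} {φ : E → ℝ} {D : E' → Matrix κ κ ℝ}
variable (W : IsWarpedOn U V A φ D) {z : E × E'} (hz : z ∈ U ×ˢ V)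
include W hz

/-- In the fiber trace of `-f T_{jk} D` the factor `f` cancels against the inverse metric, leaving
`T` times the trace of the identity, the fiber dimension. -/
theorem ricci_ll (j k : ι) :
    ricci (b.prod b') (warpedMatrix A φ D) (.inl j) (.inl k) z =
      ricci b A j k z.1 - Fintype.card κ * coordT b A φ j k z.1 := by
  have h0 := W.ne_zero _ hz.1
  have h1 : ∑ x, ∑ y, (φ z.1)⁻¹ * (D z.2)⁻¹ x y * (-φ z.1 * coordT b A φ j k z.1 * D z.2 x y) =
      -(Fintype.card κ * coordT b A φ j k z.1) := by
    rw [← W.fiber.trace_inv_mul hz.2, Finset.sum_mul, ← Finset.sum_neg_distrib]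
    refine Finset.sum_congr rfl fun x _ => ?_
    rw [Finset.sum_mul, ← Finset.sum_neg_distrib]
    refine Finset.sum_congr rfl fun y _ => ?_
    field_simp
  simp only [ricci, Fintype.sum_sum_type, W.inv_ll hz, W.inv_lr hz, W.inv_rl hz, W.inv_rr hz,
    W.riemann_llll b b' hz, W.riemann_rllr b b' hz, zero_mul, Finset.sum_const_zero, add_zero,
    zero_add, h1, sub_eq_add_neg]

theorem ricci_lr (j : ι) (k : κ) :
    ricci (b.prod b') (warpedMatrix A φ D) (.inl j) (.inr k) z = 0 := by
  -- Antisymmetry is instantiated at one index pattern only, so that `simp` cannot apply it back and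
  -- forth.
  simp [ricci, Fintype.sum_sum_type, W.inv_lr hz, W.inv_rl hz, W.riemann_rlrr b b' hz,
    riemann_antisymm (b.prod b') (warpedMatrix A φ D) (Sum.inl _) (Sum.inl j) (Sum.inl _) (Sum.inr k),
    W.riemann_lllr b b' hz]

theorem ricci_rl (j : κ) (k : ι) :
    ricci (b.prod b') (warpedMatrix A φ D) (.inr j) (.inl k) z = 0 := by
  simp [ricci, Fintype.sum_sum_type, W.inv_lr hz, W.inv_rl hz, W.riemann_lrll b b' hz,
    W.riemann_rrlr b b' hz]

/-- The two parts of `Q` come from the two traces: the base trace of the mixed block gives `-f tr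
T`, and the fiber trace of the `P` term gives `f P` times the fiber dimension minus one. -/
theorem ricci_rr (j k : κ) :
    ricci (b.prod b') (warpedMatrix A φ D) (.inr j) (.inr k) z =
      ricci b' D j k z.2 + coordQ b A φ (Fintype.card κ) z.1 * D z.2 j k := by
  have h0 := W.ne_zero _ hz.1
  have h1 : ∑ x, ∑ y, (A z.1)⁻¹ x y * (-φ z.1 * coordT b A φ x y z.1 * D z.2 j k) =
      -φ z.1 * D z.2 j k * ∑ x, ∑ y, (A z.1)⁻¹ x y * coordT b A φ x y z.1 := by
    simp only [Finset.mul_sum]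
    exact Finset.sum_congr rfl fun x _ => Finset.sum_congr rfl fun y _ => by ring
  have h2 : ∑ x, ∑ y, (D z.2)⁻¹ x y * (D z.2 x k * D z.2 j y) = D z.2 j k := by
    rw [← W.fiber.mulVec_inv hz.2 (fun y => D z.2 j y) k]
    refine Finset.sum_congr rfl fun x _ => ?_
    rw [Finset.mul_sum, W.fiber.symm _ hz.2 k x]
    exact Finset.sum_congr rfl fun y _ => by ring
  have h3 : ∑ x, ∑ y, (φ z.1)⁻¹ * (D z.2)⁻¹ x y *
      (φ z.1 * riemann b' D x j k y z.2 + φ z.1 ^ 2 * coordP b A φ z.1 *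
        (D z.2 x y * D z.2 j k - D z.2 x k * D z.2 j y)) =
      ricci b' D j k z.2 + φ z.1 * coordP b A φ z.1 * ((Fintype.card κ - 1) * D z.2 j k) := by
    rw [show φ z.1 * coordP b A φ z.1 * ((Fintype.card κ - 1) * D z.2 j k) =
      φ z.1 * coordP b A φ z.1 * D z.2 j k * ∑ x, ∑ y, (D z.2)⁻¹ x y * D z.2 x y
        - φ z.1 * coordP b A φ z.1 * ∑ x, ∑ y, (D z.2)⁻¹ x y * (D z.2 x k * D z.2 j y) by
      rw [W.fiber.trace_inv_mul hz.2, h2]; ring]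
    rw [ricci]
    simp only [← Finset.sum_sub_distrib, Finset.mul_sum,
      ← Finset.sum_add_distrib]
    refine Finset.sum_congr rfl fun x _ => Finset.sum_congr rfl fun y _ => ?_
    field_simp
  simp only [ricci, Fintype.sum_sum_type, W.inv_ll hz, W.inv_lr hz, W.inv_rl hz, W.inv_rr hz,
    W.riemann_lrrl b b' hz, W.riemann_rrrr b b' hz, zero_mul, Finset.sum_const_zero, add_zero,
    zero_add]
  rw [h1, h3, coordQ, ricci]
  ring

/-- The Roter type condition for a warped product in coordinates, at a point. -/
theorem roter_iff (N₁ N₂ N₃ : ℝ) {g : Matrix ι ι ℝ} (hg : g = A z.1)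
    {S : Matrix ι ι ℝ} (hS : S = of fun i j => ricci b A i j z.1)
    {T : Matrix ι ι ℝ} (hT : T = of fun i j => coordT b A φ i j z.1)
    {g' : Matrix κ κ ℝ} (hg' : g' = D z.2)
    {S' : Matrix κ κ ℝ} (hS' : S' = of fun i j => ricci b' D i j z.2)
    {G R : Matrix (ι ⊕ κ) (ι ⊕ κ) ℝ} (hG : G = warpedMatrix A φ D z)
    (hR : R = of fun i j => ricci (b.prod b') (warpedMatrix A φ D) i j z)
    {f P Q : ℝ} (hf : f = φ z.1) (hP : P = coordP b A φ z.1)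
    (hQ : Q = coordQ b A φ (Fintype.card κ) z.1) {q : ℝ} (hq : q = Fintype.card κ) :
    (∀ i j k l, riemann (b.prod b') (warpedMatrix A φ D) i j k l z =
      N₁ * kulkarniNomizu G G i j k l + N₂ * kulkarniNomizu G R i j k l
        + N₃ * kulkarniNomizu R R i j k l) ↔
    (∀ i j k l, riemann b A i j k l z.1 = N₁ * kulkarniNomizu g g i j k l
        + N₂ * kulkarniNomizu g S i j k l - q * N₂ * kulkarniNomizu g T i j k l
        + N₃ * kulkarniNomizu S S i j k l - 2 * q * N₃ * kulkarniNomizu S T i j k l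
        + q ^ 2 * N₃ * kulkarniNomizu T T i j k l) ∧
    (∀ i j k l, (-2 * f * N₁ - N₂ * Q) * (g i j * g' k l)
        + (-f * N₂ - 2 * N₃ * Q) * (S i j * g' k l)
        + (-f * (1 - N₂ * q) + 2 * N₃ * Q * q) * (T i j * g' k l)
        - N₂ * (g i j * S' k l) - 2 * N₃ * (S i j * S' k l)
        + 2 * N₃ * q * (T i j * S' k l) = 0) ∧
    (∀ i j k l, f * riemann b' D i j k l z.2 =
        (N₁ * f ^ 2 + N₂ * Q * f + N₃ * Q ^ 2 - f ^ 2 * P / 2) * kulkarniNomizu g' g' i j k l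
        + (f * N₂ + 2 * N₃ * Q) * kulkarniNomizu g' S' i j k l
        + N₃ * kulkarniNomizu S' S' i j k l) := by
  have Gll (i j : ι) : G (.inl i) (.inl j) = g i j := by rw [hG, hg, warpedMatrix_ll]
  have Glr (i : ι) (j : κ) : G (.inl i) (.inr j) = 0 := by rw [hG, warpedMatrix_lr]
  have Grl (i : κ) (j : ι) : G (.inr i) (.inl j) = 0 := by rw [hG, warpedMatrix_rl]
  have Grr (i j : κ) : G (.inr i) (.inr j) = f * g' i j := by rw [hG, hg', hf, warpedMatrix_rr]
  have Rll (i j : ι) : R (.inl i) (.inl j) = S i j - q * T i j := by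
    rw [hR, hS, hT, hq, of_apply, of_apply, of_apply, W.ricci_ll b b' hz]
  have Rlr (i : ι) (j : κ) : R (.inl i) (.inr j) = 0 := by
    rw [hR, of_apply, W.ricci_lr b b' hz]
  have Rrl (i : κ) (j : ι) : R (.inr i) (.inl j) = 0 := by
    rw [hR, of_apply, W.ricci_rl b b' hz]
  have Rrr (i j : κ) : R (.inr i) (.inr j) = S' i j + Q * g' i j := by
    rw [hR, hS', hQ, hg', of_apply, of_apply, W.ricci_rr b b' hz]
  have C1 := W.riemann_llll b b' hz
  have C2 (h : ι) (i j : κ) (k : ι) : riemann (b.prod b') (warpedMatrix A φ D)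
      (.inl h) (.inr i) (.inr j) (.inl k) z = -f * T h k * g' i j := by
    rw [W.riemann_lrrl b b' hz, hf, hT, hg', of_apply]
  have C3 (h : κ) (i j : ι) (k : κ) : riemann (b.prod b') (warpedMatrix A φ D)
      (.inr h) (.inl i) (.inl j) (.inr k) z = -f * T i j * g' h k := by
    rw [W.riemann_rllr b b' hz, hf, hT, hg', of_apply]
  have C4 (h i j k : κ) : riemann (b.prod b') (warpedMatrix A φ D)
      (.inr h) (.inr i) (.inr j) (.inr k) z = f * riemann b' D h i j k z.2
        + f ^ 2 * P * (g' h k * g' i j - g' h j * g' i k) := by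
    rw [W.riemann_rrrr b b' hz, hf, hP, hg']
  simp only [kulkarniNomizu]
  constructor
  · intro h
    refine ⟨fun i j k l => ?_, fun i j k l => ?_, fun i j k l => ?_⟩
    · have := h (.inl i) (.inl j) (.inl k) (.inl l)
      simp only [Gll, Rll, C1] at this
      linear_combination this
    -- With base indices outside and fiber indices inside, both negative terms of the
    -- Kulkarni-Nomizu product vanish, and `(X ∧ Y)` becomes `X_{ij} Y_{kl} + X_{kl} Y_{ij}`.
    · have := h (.inl i) (.inr k) (.inr l) (.inl j)
      simp only [Gll, Glr, Grr, Grl, Rlr, Rrl, Rll, Rrr, C2] at this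
      linear_combination this
    -- The `P` term of the curvature is `½ f² P (g' ∧ g')`; moved to the other side, it is the `-f²
    -- P / 2` of (iii).
    · have := h (.inr i) (.inr j) (.inr k) (.inr l)
      simp only [Grr, Rrr, C4] at this
      linear_combination this
  -- Of the 16 index patterns, one is (i), one is (iii), and four are (ii) up to sign; in the other
  -- ten both sides vanish.
  · rintro ⟨h1, h2, h3⟩ (i | i) (j | j) (k | k) (l | l) <;>
      simp only [Gll, Glr, Grr, Grl, Rlr, Rrl, Rll, Rrr]
    · rw [C1]; linear_combination h1 i j k l
    · rw [W.riemann_lllr b b' hz]; ring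
    · rw [riemann_antisymm, W.riemann_lllr b b' hz]; ring
    · rw [W.riemann_llrr b b' hz]; ring
    · rw [W.riemann_lrll b b' hz]; ring
    · rw [riemann_antisymm, C2]; linear_combination -h2 i k j l
    · rw [C2]; linear_combination h2 i l j k
    · rw [W.riemann_lrrr b b' hz]; ring
    · rw [W.riemann_rlll b b' hz]; ring
    · rw [C3]; linear_combination h2 j k i l
    · rw [riemann_antisymm, C3]; linear_combination -h2 j l i k
    · rw [W.riemann_rlrr b b' hz]; ring
    · rw [W.riemann_rrll b b' hz]; ring
    · rw [W.riemann_rrlr b b' hz]; ring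
    · rw [riemann_antisymm, W.riemann_rrlr b b' hz]; ring
    · rw [C4]; linear_combination h3 i j k l

end IsWarpedOn
end WarpedRicci

/-! ### Metric components in a chart -/

section Charts

variable {E : Type*} [NormedAddCommGroup E] [NormedSpace ℝ E]
variable {H : Type*} [TopologicalSpace H] {I : ModelWithCorners ℝ E H}
variable {M : Type*} [TopologicalSpace M] [ChartedSpace H M]
variable {ι : Type*}

theorem mfderiv_extend_symm_sum [Fintype ι] (b : Module.Basis ι ℝ E)
    (e : OpenPartialHomeomorph M H) (c : ι → ℝ) (u : E) :
    mfderiv 𝓘(ℝ, E) I (e.extend I).symm u (∑ i, c i • b i) =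
      ∑ i, c i • coordVec I b e i u := by
  -- Tangent spaces unfold to the model space; this type hides the base point, so that linearity can
  -- be applied by `simp`.
  let L : E →L[ℝ] E := mfderiv 𝓘(ℝ, E) I (e.extend I).symm u
  have : L (∑ i, c i • b i) = ∑ i, c i • L (b i) := by simp
  exact this

variable [IsManifold I ∞ M]
variable {e : OpenPartialHomeomorph M H} (he : e ∈ atlas H M)
include he

theorem contMDiffOn_extend_symm_target :
    ContMDiffOn 𝓘(ℝ, E) I ∞ (e.extend I).symm (e.extend I).target := by
  rw [e.extend_target']
  exact contMDiffOn_extend_symm (IsManifold.subset_maximalAtlas he)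

theorem mdifferentiableAt_extend {x : M} (hx : x ∈ e.source) :
    MDifferentiableAt I 𝓘(ℝ, E) (e.extend I) x :=
  (I.contMDiff.contMDiffAt.comp x ((contMDiffOn_of_mem_maximalAtlas (n := ∞)
    (IsManifold.subset_maximalAtlas he)).contMDiffAt
      (e.open_source.mem_nhds hx))).mdifferentiableAt (by simp)

variable [I.Boundaryless]

theorem mdifferentiableAt_extend_symm {u : E} (hu : u ∈ (e.extend I).target) :
    MDifferentiableAt 𝓘(ℝ, E) I (e.extend I).symm u :=
  ((contMDiffOn_extend_symm_target he).contMDiffAt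
    (e.isOpen_extend_target.mem_nhds hu)).mdifferentiableAt (by simp)

/-- The chain rule for the two composites of the chart and its inverse, each locally the identity:
one yields injectivity, the other surjectivity. -/
theorem mfderiv_extend_symm_bijective {u : E} (hu : u ∈ (e.extend I).target) :
    Function.Bijective (mfderiv 𝓘(ℝ, E) I (e.extend I).symm u) := by
  rw [← (e.extend I).image_source_eq_target, e.extend_source] at hu
  obtain ⟨x, hx, rfl⟩ := hu
  have hu : e.extend I x ∈ (e.extend I).target :=
    (e.extend I).map_source (by rwa [e.extend_source])
  have hx' := e.extend_left_inv (I := I) hx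
  have h1 := mdifferentiableAt_extend (I := I) he hx
  have h2 := mdifferentiableAt_extend_symm (I := I) he hu
  constructor
  · have h1' : MDifferentiableAt I 𝓘(ℝ, E) (e.extend I) ((e.extend I).symm (e.extend I x)) := by
      rwa [hx']
    have h3 := mfderiv_comp _ h1' h2
    have h4 : e.extend I ∘ (e.extend I).symm =ᶠ[𝓝 (e.extend I x)] id :=
      Filter.eventually_of_mem (e.isOpen_extend_target.mem_nhds hu)
        fun y hy => (e.extend I).right_inv hy
    rw [h4.mfderiv_eq, mfderiv_id] at h3
    intro v w hvw
    have hv := DFunLike.congr_fun h3 v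
    have hw := DFunLike.congr_fun h3 w
    exact hv.trans ((congrArg (mfderiv I 𝓘(ℝ, E) (e.extend I) _) hvw).trans hw.symm)
  · have h3 := mfderiv_comp x h2 h1
    have h4 : (e.extend I).symm ∘ e.extend I =ᶠ[𝓝 x] id :=
      Filter.eventually_of_mem (e.open_source.mem_nhds hx) fun y hy => e.extend_left_inv hy
    rw [h4.mfderiv_eq, mfderiv_id] at h3
    exact fun v => ⟨mfderiv I 𝓘(ℝ, E) (e.extend I) x v, (DFunLike.congr_fun h3 v).symm⟩

/-- The coordinate field is the tangent map of the inverse chart applied to the constant section `u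
↦ (u, b i)`. -/
theorem contMDiffOn_coordVec (b : Module.Basis ι ℝ E) (i : ι) :
    ContMDiffOn 𝓘(ℝ, E) (I.prod 𝓘(ℝ, E)) ∞
      (fun u => (Bundle.TotalSpace.mk' E ((e.extend I).symm u) (coordVec I b e i u) :
        TangentBundle I M)) (e.extend I).target := by
  have hU : IsOpen (e.extend I).target := e.isOpen_extend_target
  have h1 := (contMDiffOn_extend_symm_target (I := I) he).contMDiffOn_tangentMapWithin
    (m := ∞) (by simp) hU.uniqueMDiffOn
  have h2 : ContMDiff 𝓘(ℝ, E) (𝓘(ℝ, E).prod 𝓘(ℝ, E)) ∞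
      (fun u => (⟨u, b i⟩ : TangentBundle 𝓘(ℝ, E) E)) := by
    rw [← contMDiffOn_univ]
    exact contMDiffOn_vectorSpace_iff_contDiffOn.2 contDiffOn_const
  have h3 := h1.comp (h2.contMDiffOn (s := (e.extend I).target)) (fun u hu => hu)
  refine h3.congr fun u hu => ?_
  simp only [Function.comp, tangentMapWithin, coordVec, mfderivWithin_of_isOpen hU hu]

/-- Smoothness: the components contract a smooth section with two smooth fields. Invertibility: a
null vector of the matrix would give a combination of the coordinate fields orthogonal to
everything, as these fields span; nondegeneracy makes it zero, against their independence. -/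
theorem isMetricOn_components [Fintype ι] [DecidableEq ι] (b : Module.Basis ι ℝ E) (g : SemiRiemannianMetric I M) :
    IsMetricOn (e.extend I).target (components I b g.val e) where
  isOpen := e.isOpen_extend_target
  symm u _ i j := g.symm _ _ _
  smooth i j := by
    rw [← contMDiffOn_iff_contDiffOn]
    intro u hu
    have : ContMDiffWithinAt 𝓘(ℝ, E) (I.prod 𝓘(ℝ)) ∞
        (fun u ↦ Bundle.TotalSpace.mk' ℝ (E := Bundle.Trivial M ℝ) ((e.extend I).symm u)
          (g.val ((e.extend I).symm u) (coordVec I b e i u) (coordVec I b e j u)))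
        (e.extend I).target u := by
      apply ContMDiffWithinAt.clm_bundle_apply₂ (F₁ := E) (F₂ := E)
      · exact ContMDiffAt.comp_contMDiffWithinAt u g.smooth.contMDiffAt
          (contMDiffOn_extend_symm_target he u hu)
      · exact contMDiffOn_coordVec he b i u hu
      · exact contMDiffOn_coordVec he b j u hu
    simp only [Bundle.contMDiffWithinAt_totalSpace] at this
    exact this.2
  isUnit_det u hu := by
    rw [isUnit_iff_ne_zero]
    intro h0
    obtain ⟨v, hv, hv0⟩ := exists_vecMul_eq_zero_iff.2 h0
    have hw : ∀ y : TangentSpace I ((e.extend I).symm u),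
        g.val _ (∑ i, v i • coordVec I b e i u) y = 0 := by
      intro y
      obtain ⟨t, rfl⟩ := (mfderiv_extend_symm_bijective he hu).2 y
      have ht := (congrArg (mfderiv 𝓘(ℝ, E) I (e.extend I).symm u) (b.sum_repr t).symm).trans
        (mfderiv_extend_symm_sum b e (b.repr t) u)
      refine (congrArg _ ht).trans ?_
      rw [map_sum]
      refine Finset.sum_eq_zero fun j _ => ?_
      have := congrFun hv0 j
      simp only [vecMul, dotProduct, Pi.zero_apply] at this
      rw [map_smul, map_sum, _root_.sum_apply]
      simp only [map_smul, _root_.smul_apply]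
      exact smul_eq_zero_of_right _ this
    have h1 := g.nondegenerate _ _ hw
    have h2 := (mfderiv_extend_symm_sum b e v u).trans h1
    have h3 : ∑ i, v i • b i = 0 :=
      (mfderiv_extend_symm_bijective he hu).1 (h2.trans (map_zero _).symm)
    exact hv (funext (Fintype.linearIndependent_iff.1 b.linearIndependent v h3))

end Charts

/-! ### Warped metrics in product charts -/

section WarpedCharts

variable {E : Type*} [NormedAddCommGroup E] [NormedSpace ℝ E]
  {H : Type*} [TopologicalSpace H] {I : ModelWithCorners ℝ E H}
  {E' : Type*} [NormedAddCommGroup E'] [NormedSpace ℝ E']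
  {H' : Type*} [TopologicalSpace H'] {I' : ModelWithCorners ℝ E' H'}
  {B : Type*} [TopologicalSpace B] [ChartedSpace H B]
  {F : Type*} [TopologicalSpace F] [ChartedSpace H' F]

theorem warpedMetric_apply (gB : BilinField I B) (f : B → ℝ) (gF : BilinField I' F) (x : B × F)
    (v w : TangentSpace (I.prod I') x) :
    warpedMetric gB f gF x v w = gB x.1 v.1 w.1 + f x.1 * gF x.2 v.2 w.2 := by
  simp only [warpedMetric, mfderiv_fst, mfderiv_snd]
  rfl

variable [I.Boundaryless] [I'.Boundaryless] [IsManifold I ∞ B] [IsManifold I' ∞ F]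
  {ι : Type*} {κ : Type*} (b : Module.Basis ι ℝ E) (b' : Module.Basis κ ℝ E')
  {e : OpenPartialHomeomorph B H} (he : e ∈ atlas H B)
  {e' : OpenPartialHomeomorph F H'} (he' : e' ∈ atlas H' F)
include he he'

/-- The inverse of a product chart has the product derivative, so its coordinate fields are `(∂_a,
0)` and `(0, ∂_α)`. -/
theorem components_warpedMetric (gB : BilinField I B) (f : B → ℝ) (gF : BilinField I' F) :
    Set.EqOn (components (I.prod I') (b.prod b') (warpedMetric gB f gF) (e.prod e'))
      (warpedMatrix (components I b gB e) (f ∘ (e.extend I).symm) (components I' b' gF e'))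
      ((e.extend I).target ×ˢ (e'.extend I').target) := by
  intro z hz
  have h1 := mdifferentiableAt_extend_symm he hz.1
  have h2 := mdifferentiableAt_extend_symm he' hz.2
  have hd (v : E × E') : mfderiv 𝓘(ℝ, E × E') (I.prod I')
      ((e.prod e').extend (I.prod I')).symm z v =
      (mfderiv 𝓘(ℝ, E) I (e.extend I).symm z.1 v.1,
        mfderiv 𝓘(ℝ, E') I' (e'.extend I').symm z.2 v.2) := by
    have := mfderiv_prodMap h1 h2
    -- `mfderiv_prodMap` uses the product of the two model structures on `E × E'`; it is identified
    -- here with the structure of `E × E'` over itself.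
    rw [← modelWithCornersSelf_prod, chartedSpaceSelf_prod] at this
    exact DFunLike.congr_fun this v
  have hl (i : ι) : coordVec (I.prod I') (b.prod b') (e.prod e') (.inl i) z =
      (coordVec I b e i z.1, (0 : TangentSpace I' ((e'.extend I').symm z.2))) := by
    refine (hd _).trans (Prod.ext ?_ ?_)
    · exact congrArg (mfderiv 𝓘(ℝ, E) I (e.extend I).symm z.1) (b.prod_apply_inl_fst b' i)
    · exact (congrArg (mfderiv 𝓘(ℝ, E') I' (e'.extend I').symm z.2)
        (b.prod_apply_inl_snd b' i)).trans
          (map_zero (mfderiv 𝓘(ℝ, E') I' (e'.extend I').symm z.2))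
  have hr (i : κ) : coordVec (I.prod I') (b.prod b') (e.prod e') (.inr i) z =
      ((0 : TangentSpace I ((e.extend I).symm z.1)), coordVec I' b' e' i z.2) := by
    refine (hd _).trans (Prod.ext ?_ ?_)
    · exact (congrArg (mfderiv 𝓘(ℝ, E) I (e.extend I).symm z.1)
        (b.prod_apply_inr_fst b' i)).trans
          (map_zero (mfderiv 𝓘(ℝ, E) I (e.extend I).symm z.1))
    · exact congrArg (mfderiv 𝓘(ℝ, E') I' (e'.extend I').symm z.2) (b.prod_apply_inr_snd b' i)
  have hv (v v' : TangentSpace I ((e.extend I).symm z.1))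
      (w w' : TangentSpace I' ((e'.extend I').symm z.2)) :
      warpedMetric gB f gF ((e.extend I).symm z.1, (e'.extend I').symm z.2) (v, w) (v', w') =
        gB _ v v' + f ((e.extend I).symm z.1) * gF _ w w' :=
    warpedMetric_apply gB f gF _ _ _
  have hg {i j : ι ⊕ κ} {v v' : TangentSpace I ((e.extend I).symm z.1)}
      {w w' : TangentSpace I' ((e'.extend I').symm z.2)}
      (h : coordVec (I.prod I') (b.prod b') (e.prod e') i z = (v, w))
      (h' : coordVec (I.prod I') (b.prod b') (e.prod e') j z = (v', w')) :
      components (I.prod I') (b.prod b') (warpedMetric gB f gF) (e.prod e') z i j =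
        gB _ v v' + f ((e.extend I).symm z.1) * gF _ w w' :=
    (congrArg₂ (fun X Y => warpedMetric gB f gF
      ((e.extend I).symm z.1, (e'.extend I').symm z.2) X Y) h h').trans (hv v v' w w')
  ext (i | i) (j | j)
  · rw [hg (hl i) (hl j), map_zero, mul_zero, add_zero]
    rfl
  · rw [hg (hl i) (hr j), map_zero, map_zero, _root_.zero_apply, mul_zero, add_zero]
    rfl
  · rw [hg (hr i) (hl j), map_zero, map_zero, _root_.zero_apply, mul_zero, add_zero]
    rfl
  · rw [hg (hr i) (hr j), map_zero, zero_add]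
    rfl

theorem isWarpedOn_components [Fintype ι] [DecidableEq ι] [Fintype κ] [DecidableEq κ]
    (gB : SemiRiemannianMetric I B) (gF : SemiRiemannianMetric I' F) {f : B → ℝ}
    (hf : ContMDiff I 𝓘(ℝ, ℝ) ∞ f) (hf0 : ∀ x, f x ≠ 0) :
    IsWarpedOn (e.extend I).target (e'.extend I').target (components I b gB.val e)
      (f ∘ (e.extend I).symm) (components I' b' gF.val e') where
  base := isMetricOn_components he b gB
  fiber := isMetricOn_components he' b' gF
  smooth := contMDiffOn_iff_contDiffOn.1 (hf.comp_contMDiffOn (contMDiffOn_extend_symm_target he))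
  ne_zero _ _ := hf0 _

end WarpedCharts

/-! ### The Roter equation in product charts -/

section RoterCharts

variable {E : Type*} [NormedAddCommGroup E] [NormedSpace ℝ E]
  {H : Type*} [TopologicalSpace H] {I : ModelWithCorners ℝ E H} [I.Boundaryless]
  {E' : Type*} [NormedAddCommGroup E'] [NormedSpace ℝ E']
  {H' : Type*} [TopologicalSpace H'] {I' : ModelWithCorners ℝ E' H'} [I'.Boundaryless]
  {B : Type*} [TopologicalSpace B] [ChartedSpace H B] [IsManifold I ∞ B]
  {F : Type*} [TopologicalSpace F] [ChartedSpace H' F] [IsManifold I' ∞ F]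
  {ι : Type*} [Fintype ι] [DecidableEq ι] {κ : Type*} [Fintype κ] [DecidableEq κ]
  (b : Module.Basis ι ℝ E) (b' : Module.Basis κ ℝ E')

/-- The Roter type condition for a warped product in a product chart, at a point. -/
theorem roter_warpedMetric_iff {e : OpenPartialHomeomorph B H} (he : e ∈ atlas H B)
    {e' : OpenPartialHomeomorph F H'} (he' : e' ∈ atlas H' F)
    (gB : SemiRiemannianMetric I B) (gF : SemiRiemannianMetric I' F) {f : B → ℝ}
    (hf : ContMDiff I 𝓘(ℝ, ℝ) ∞ f) (hf0 : ∀ x, f x ≠ 0)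
    {x : B} (hx : x ∈ e.source) {y : F} (hy : y ∈ e'.source) (N₁ N₂ N₃ : ℝ) :
    letI G := metricAt (I.prod I') (b.prod b') (warpedMetric gB.val f gF.val) (e.prod e') (x, y)
    letI R := ricciAt (I.prod I') (b.prod b') (warpedMetric gB.val f gF.val) (e.prod e') (x, y)
    letI g := metricAt I b gB.val e x
    letI S := ricciAt I b gB.val e x
    letI T := tensorT I b gB.val f e x
    letI P := scalarP I b gB.val f e x
    letI Q := scalarQ I b gB.val f (Fintype.card κ) e x
    letI g' := metricAt I' b' gF.val e' y
    letI S' := ricciAt I' b' gF.val e' y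
    letI q : ℝ := Fintype.card κ
    (∀ i j k l, riemannAt (I.prod I') (b.prod b') (warpedMetric gB.val f gF.val) (e.prod e')
        (x, y) i j k l = N₁ * kulkarniNomizu G G i j k l + N₂ * kulkarniNomizu G R i j k l
          + N₃ * kulkarniNomizu R R i j k l) ↔
    (∀ i j k l, riemannAt I b gB.val e x i j k l = N₁ * kulkarniNomizu g g i j k l
        + N₂ * kulkarniNomizu g S i j k l - q * N₂ * kulkarniNomizu g T i j k l
        + N₃ * kulkarniNomizu S S i j k l - 2 * q * N₃ * kulkarniNomizu S T i j k l
        + q ^ 2 * N₃ * kulkarniNomizu T T i j k l) ∧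
    (∀ i j k l, (-2 * f x * N₁ - N₂ * Q) * (g i j * g' k l)
        + (-f x * N₂ - 2 * N₃ * Q) * (S i j * g' k l)
        + (-f x * (1 - N₂ * q) + 2 * N₃ * Q * q) * (T i j * g' k l)
        - N₂ * (g i j * S' k l) - 2 * N₃ * (S i j * S' k l)
        + 2 * N₃ * q * (T i j * S' k l) = 0) ∧
    (∀ i j k l, f x * riemannAt I' b' gF.val e' y i j k l =
        (N₁ * f x ^ 2 + N₂ * Q * f x + N₃ * Q ^ 2 - f x ^ 2 * P / 2) * kulkarniNomizu g' g' i j k l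
        + (f x * N₂ + 2 * N₃ * Q) * kulkarniNomizu g' S' i j k l
        + N₃ * kulkarniNomizu S' S' i j k l) := by
  have W := isWarpedOn_components b b' he he' gB gF hf hf0
  have hU := W.isOpen
  have hG := components_warpedMetric b b' he he' gB.val f gF.val
  have hz : (e.extend I x, e'.extend I' y) ∈ (e.extend I).target ×ˢ (e'.extend I').target :=
    ⟨(e.extend I).map_source (by rwa [e.extend_source]),
      (e'.extend I').map_source (by rwa [e'.extend_source])⟩
  -- `tensorT`, `scalarP` and `scalarQ` use the value `f x`, their coordinate versions the value of
  -- `f` read in the chart.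
  have hfx : f x = (f ∘ (e.extend I).symm) (e.extend I x) := by
    rw [Function.comp_apply, e.extend_left_inv hx]
  have hT : tensorT I b gB.val f e x = of fun i j =>
      coordT b (components I b gB.val e) (f ∘ (e.extend I).symm) i j (e.extend I x) := by
    ext i j
    simp only [tensorT, coordT, of_apply, ← hfx]
  have hP : scalarP I b gB.val f e x =
      coordP b (components I b gB.val e) (f ∘ (e.extend I).symm) (e.extend I x) := by
    simp only [scalarP, coordP, ← hfx, metricAt]
  have hQ : scalarQ I b gB.val f (Fintype.card κ) e x =
      coordQ b (components I b gB.val e) (f ∘ (e.extend I).symm) (Fintype.card κ)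
        (e.extend I x) := by
    simp only [scalarQ, coordQ, traceT, hP, hT, ← hfx, metricAt, of_apply]
  have hR (i j k l : ι ⊕ κ) : riemannAt (I.prod I') (b.prod b') (warpedMetric gB.val f gF.val)
      (e.prod e') (x, y) i j k l = riemann (b.prod b') (warpedMatrix (components I b gB.val e)
        (f ∘ (e.extend I).symm) (components I' b' gF.val e')) i j k l
          (e.extend I x, e'.extend I' y) :=
    riemann_congr (b.prod b') hU hG hz i j k l
  have hS : ricciAt (I.prod I') (b.prod b') (warpedMetric gB.val f gF.val) (e.prod e') (x, y) =
      of fun i j => ricci (b.prod b') (warpedMatrix (components I b gB.val e)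
        (f ∘ (e.extend I).symm) (components I' b' gF.val e')) i j
          (e.extend I x, e'.extend I' y) := by
    ext i j
    exact ricci_congr (b.prod b') hU hG hz i j
  simp only [hR]
  exact W.roter_iff b b' hz N₁ N₂ N₃ rfl rfl hT rfl rfl (hG hz) hS hfx hP hQ rfl

end RoterCharts

end WarpedRoter

end

/-! ### The characterization on manifolds -/

theorem corollary5p2 (p q : ℕ) (hp : 1 ≤ p) (hq : 1 ≤ q) (hn : 3 ≤ p + q)
    {B : Type*} [TopologicalSpace B] [ChartedSpace (EuclideanSpace ℝ (Fin p)) B]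
    [IsManifold (𝓡 p) ∞ B] [ConnectedSpace B]
    {F : Type*} [TopologicalSpace F] [ChartedSpace (EuclideanSpace ℝ (Fin q)) F]
    [IsManifold (𝓡 q) ∞ F] [ConnectedSpace F]
    (gB : SemiRiemannianMetric (𝓡 p) B)
    (gF : SemiRiemannianMetric (𝓡 q) F)
    (f : B → ℝ) (hf : ContMDiff (𝓡 p) 𝓘(ℝ, ℝ) ∞ f) (hfpos : ∀ x, 0 < f x)
    (hflat : ¬ IsFlat ((𝓡 p).prod (𝓡 q))
      ((coords p).prod (coords q))
      (warpedMetric gB.val f gF.val))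
    (N₁ N₂ N₃ : B × F → ℝ) :
    IsRoterTypeWith ((𝓡 p).prod (𝓡 q))
        ((coords p).prod (coords q))
        (warpedMetric gB.val f gF.val) N₁ N₂ N₃ ↔
      -- (i) the curvature tensor of the base
      (∀ e ∈ atlas (EuclideanSpace ℝ (Fin p)) B, ∀ x ∈ e.source, ∀ y : F,
        letI g := metricAt (𝓡 p) (coords p) gB.val e x
        letI S := ricciAt (𝓡 p) (coords p) gB.val e x
        letI T := tensorT (𝓡 p) (coords p) gB.val f e x
        ∀ a b c d : Fin p,
          riemannAt (𝓡 p) (coords p) gB.val e x a b c d =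
            N₁ (x, y) * kulkarniNomizu g g a b c d
            + N₂ (x, y) * kulkarniNomizu g S a b c d
            - (q : ℝ) * N₂ (x, y) * kulkarniNomizu g T a b c d
            + N₃ (x, y) * kulkarniNomizu S S a b c d
            - 2 * (q : ℝ) * N₃ (x, y) * kulkarniNomizu S T a b c d
            + (q : ℝ) ^ 2 * N₃ (x, y) * kulkarniNomizu T T a b c d) ∧
      -- (ii) the mixed condition
      (∀ e ∈ atlas (EuclideanSpace ℝ (Fin p)) B, ∀ x ∈ e.source,
        ∀ e' ∈ atlas (EuclideanSpace ℝ (Fin q)) F, ∀ y ∈ e'.source,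
        letI g := metricAt (𝓡 p) (coords p) gB.val e x
        letI S := ricciAt (𝓡 p) (coords p) gB.val e x
        letI T := tensorT (𝓡 p) (coords p) gB.val f e x
        letI Q := scalarQ (𝓡 p) (coords p) gB.val f q e x
        letI g' := metricAt (𝓡 q) (coords q) gF.val e' y
        letI S' := ricciAt (𝓡 q) (coords q) gF.val e' y
        ∀ (a b : Fin p) (α β : Fin q),
          (-2 * f x * N₁ (x, y) - N₂ (x, y) * Q) * (g a b * g' α β)
            + (-f x * N₂ (x, y) - 2 * N₃ (x, y) * Q) * (S a b * g' α β)
            + (-f x * (1 - N₂ (x, y) * q) + 2 * N₃ (x, y) * Q * q) * (T a b * g' α β)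
            - N₂ (x, y) * (g a b * S' α β)
            - 2 * N₃ (x, y) * (S a b * S' α β)
            + 2 * N₃ (x, y) * q * (T a b * S' α β) = 0) ∧
      -- (iii) the curvature tensor of the fiber
      (∀ e ∈ atlas (EuclideanSpace ℝ (Fin p)) B, ∀ x ∈ e.source,
        ∀ e' ∈ atlas (EuclideanSpace ℝ (Fin q)) F, ∀ y ∈ e'.source,
        letI P := scalarP (𝓡 p) (coords p) gB.val f e x
        letI Q := scalarQ (𝓡 p) (coords p) gB.val f q e x
        letI g' := metricAt (𝓡 q) (coords q) gF.val e' y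
        letI S' := ricciAt (𝓡 q) (coords q) gF.val e' y
        ∀ α β γ δ : Fin q,
          f x * riemannAt (𝓡 q) (coords q) gF.val e' y α β γ δ =
            (N₁ (x, y) * f x ^ 2 + N₂ (x, y) * Q * f x + N₃ (x, y) * Q ^ 2 - f x ^ 2 * P / 2)
                * kulkarniNomizu g' g' α β γ δ
            + (f x * N₂ (x, y) + 2 * N₃ (x, y) * Q) * kulkarniNomizu g' S' α β γ δ
            + N₃ (x, y) * kulkarniNomizu S' S' α β γ δ) := by
  have key {e} (he : e ∈ atlas (EuclideanSpace ℝ (Fin p)) B)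
      {e'} (he' : e' ∈ atlas (EuclideanSpace ℝ (Fin q)) F) {x : B} (hx : x ∈ e.source)
      {y : F} (hy : y ∈ e'.source) :=
    roter_warpedMetric_iff (coords p) (coords q) he he' gB gF hf (fun x => (hfpos x).ne') hx hy
      (N₁ (x, y)) (N₂ (x, y)) (N₃ (x, y))
  simp only [Fintype.card_fin] at key
  constructor
  · intro h
    have h' {e} (he : e ∈ atlas (EuclideanSpace ℝ (Fin p)) B)
        {e'} (he' : e' ∈ atlas (EuclideanSpace ℝ (Fin q)) F) {x : B} (hx : x ∈ e.source)
        {y : F} (hy : y ∈ e'.source) :=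
      (key he he' hx hy).1 (h (e.prod e') (Set.mem_image2_of_mem he he') (x, y) ⟨hx, hy⟩)
    -- Condition (i) involves no fiber chart, so any chart around `y` will do, for instance the
    -- preferred one.
    exact ⟨fun e he x hx y =>
        (h' he (chart_mem_atlas _ y) hx (mem_chart_source _ y)).1,
      fun e he x hx e' he' y hy => (h' he he' hx hy).2.1,
      fun e he x hx e' he' y hy => (h' he he' hx hy).2.2⟩
  -- A chart in the product atlas is by definition some `e.prod e'`, so the equivalence in product
  -- charts covers every case.
  · rintro ⟨h1, h2, h3⟩ _ ⟨e, he, e', he', rfl⟩ ⟨x, y⟩ hxy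
    exact (key he he' hxy.1 hxy.2).2
      ⟨h1 e he x hxy.1 y, h2 e he x hxy.1 e' he' y hxy.2, h3 e he x hxy.1 e' he' y hxy.2⟩
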